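/- All groups are profinite, all subgroups are closed, and classes of finite groups are closed under isomorphism. A profinite group $G$ is just infinite if it is infinite and every nontrivial normal subgroup of $G$ has finite index; it is virtually pronilpotent if it has an open subgroup that is an inverse limit of finite nilpotent groups. A chief factor of $G$ is a quotient $K/L$ with $L < K$ normal subgroups of $G$ such that no normal subgroup $M$ of $G$ satisfies $L < M < K$; chief factors are counted as pairs $(K,L)$. A group is characteristically simple if it is nontrivial and has no proper nontrivial characteristic subgroup. A class $\mathcal{C}$ of finite groups satisfies condition $(*)$ if every member of $\mathcal{C}$ is characteristically simple and, for each prime $p$ such that $\mathcal{C}$ contains some elementary abelian $p$-group, $\mathcal{C}$ contains all nontrivial finite elementary abelian $p$-groups and all direct powers $S^k$ $(k \ge 1)$ of all finite simple groups $S$ such that $p$ divides the order of the Schur multiplier $H_2(S,\mathbb{Z})$ of $S$. Corollary 4.5. Let $G$ be a just infinite profinite group that is not virtually pronilpotent, and let $\mathcal{C}_1, \mathcal{C}_2, \dots$ be a sequence of classes of finite groups, each satisfying $(*)$, such that for every $n$ infinitely many chief factors of $G$ belong to $\mathcal{C}_n$. Then there are an inverse system of finite groups and surjective homomorphisms $\{(G_n)_{n>0},\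 \rho_n : G_{n+1} \twoheadrightarrow G_n\}$, whose inverse limit is isomorphic to $G$ as a topological group, and nontrivial normal subgroups $A_n$ of $G_n$, such that, setting $P_n = \rho_n(A_{n+1})$, the following hold for all $n > 0$: (i) $\mathrm{M}_{G_{n+1}}(A_{n+1}) \ge \ker \rho_n \ge P_{n+1}$, where $\mathrm{M}_{H}(A)$ denotes the intersection of all maximal $H$-invariant proper subgroups of the nontrivial normal subgroup $A$ of the finite group $H$; (ii) each normal subgroup of $G_n$ contains $P_n$ or is contained in $A_n$ (or both); (iii) $P_n$ is a minimal normal subgroup of $G_n$; (iv) $P_n \in \mathcal{C}_n$; (v) $\mathrm{C}_{G_n}(P_n) < A_n$ (proper containment). -/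

import Mathlib

universe u

namespace JustInf

section Profinite

variable (G : Type u) [Group G] [TopologicalSpace G]

/-- A profinite group is just infinite if it is infinite and each of its nontrivial
(closed) normal subgroups has finite index. -/
structure IsJustInfinite : Prop where
  infinite : Infinite G
  finiteIndex : ∀ N : Subgroup G, N.Normal → IsClosed (N : Set G) → N ≠ ⊥ → N.FiniteIndex

/-- A profinite group is pronilpotent if it is an inverse limit of finite nilpotent groups,
that is, if all its quotients by open normal subgroups are nilpotent. -/
def IsPronilpotent : Prop :=
  ∀ N : OpenNormalSubgroup G, Group.IsNilpotent (G ⧸ N.toSubgroup)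

/-- Some open subgroup is pronilpotent. -/
def IsVirtuallyPronilpotent : Prop :=
  ∃ H : OpenSubgroup G, IsPronilpotent H

/-- A chief factor `K / L` of a profinite group: `L < K` are closed normal subgroups and there
is no closed normal subgroup strictly between them. -/
@[ext]
structure ChiefFactor where
  K : Subgroup G
  L : Subgroup G
  normal_K : K.Normal
  normal_L : L.Normal
  closed_K : IsClosed (K : Set G)
  closed_L : IsClosed (L : Set G)
  lt : L < K
  chief : ∀ M : Subgroup G, M.Normal → IsClosed (M : Set G) → ¬ (L < M ∧ M < K)

variable {G}

instance (F : ChiefFactor G) : (F.L.subgroupOf F.K).Normal :=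
  F.normal_L.subgroupOf F.K

/-- The group `K / L`. -/
abbrev ChiefFactor.Quot (F : ChiefFactor G) : Type u :=
  F.K ⧸ F.L.subgroupOf F.K

end Profinite

section FiniteGroups

/-- A class of finite groups, closed under isomorphism. -/
structure FiniteGroupClass where
  Mem : ∀ (H : Type u) [Group H], Prop
  finite_of_mem : ∀ (H : Type u) [Group H], Mem H → Finite H
  mem_of_mulEquiv : ∀ (H K : Type u) [Group H] [Group K], Nonempty (H ≃* K) → Mem H → Mem K

/-- A nontrivial group without proper nontrivial characteristic subgroups. -/
def IsCharacteristicallySimple (H : Type u) [Group H] : Prop :=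
  Nontrivial H ∧ ∀ N : Subgroup H, N.Characteristic → N = ⊥ ∨ N = ⊤

/-- Nontrivial finite elementary abelian `p`-groups. -/
def IsElementaryAbelian (p : ℕ) (H : Type u) [Group H] : Prop :=
  Finite H ∧ Nontrivial H ∧ (∀ x y : H, x * y = y * x) ∧ ∀ x : H, x ^ p = 1

/-- The Schur multiplier `H₂(S, ℤ)`, with trivial action of `S` on the integers. The integers
are lifted to the universe of `S`. -/
noncomputable abbrev SchurMultiplier (S : Type u) [Group S] : Type u :=
  groupHomology (Rep.trivial (ULift.{u} ℤ) S (ULift.{u} ℤ)) 2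

/-- The condition `(*)` on a class of finite groups. -/
structure FiniteGroupClass.Star (C : FiniteGroupClass.{u}) : Prop where
  charSimple : ∀ (H : Type u) [Group H], C.Mem H → IsCharacteristicallySimple H
  elementaryAbelian_mem : ∀ p : ℕ, p.Prime →
    (∃ (H : Type u) (_ : Group H), C.Mem H ∧ IsElementaryAbelian p H) →
      ∀ (E : Type u) [Group E], IsElementaryAbelian p E → C.Mem E
  power_mem : ∀ p : ℕ, p.Prime →
    (∃ (H : Type u) (_ : Group H), C.Mem H ∧ IsElementaryAbelian p H) →
      ∀ (S : Type u) [Group S], Finite S → IsSimpleGroup S → p ∣ Nat.card (SchurMultiplier S) →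
        ∀ k : ℕ, 0 < k → C.Mem (Fin k → S)

/-- For a normal subgroup `A` of a finite group `G`: the intersection of all maximal
(proper) `G`-invariant subgroups of `A`. -/
def relMelnikov {G : Type u} [Group G] (A : Subgroup G) : Subgroup G :=
  A ⊓ sInf {M : Subgroup G | Maximal (fun N : Subgroup G => N.Normal ∧ N < A) M}

/-- `P` is a minimal normal subgroup of `G`. -/
def IsMinimalNormal {G : Type u} [Group G] (P : Subgroup G) : Prop :=
  Minimal (fun N : Subgroup G => N.Normal ∧ N ≠ ⊥) P

end FiniteGroups

/-- An inverse system `G₁ ↞ G₂ ↞ ⋯` of finite groups with surjective connecting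
homomorphisms. The index `n : ℕ` stands for the positive integer `n + 1`. -/
structure FiniteInverseSystem where
  obj : ℕ → Type u
  [group : ∀ n, Group (obj n)]
  [finite : ∀ n, Finite (obj n)]
  map : ∀ n, obj (n + 1) →* obj n
  surjective : ∀ n, Function.Surjective (map n)

namespace FiniteInverseSystem

variable (Λ : FiniteInverseSystem.{u})

instance (n : ℕ) : Group (Λ.obj n) := Λ.group n

instance (n : ℕ) : Finite (Λ.obj n) := Λ.finite n

/-- The finite groups of the system are discrete. -/
instance (n : ℕ) : TopologicalSpace (Λ.obj n) := ⊥

instance (n : ℕ) : DiscreteTopology (Λ.obj n) := ⟨rfl⟩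

/-- The inverse limit, as a subgroup of the product, with the subspace topology of the product
topology. -/
def limit : Subgroup (∀ n, Λ.obj n) where
  carrier := {x | ∀ n, Λ.map n (x (n + 1)) = x n}
  one_mem' := fun n => by simp
  mul_mem' := fun {x y} hx hy n => by
    simp only [Set.mem_ofPred_eq] at hx hy
    simp [hx n, hy n]
  inv_mem' := fun {x} hx n => by
    simp only [Set.mem_ofPred_eq] at hx
    simp [hx n]

/-- The subgroup `Pₙ = ρₙ(Aₙ₊₁)` of `Gₙ`. -/
def P (A : ∀ n, Subgroup (Λ.obj n)) (n : ℕ) : Subgroup (Λ.obj n) :=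
  (A (n + 1)).map (Λ.map n)

end FiniteInverseSystem

end JustInf

open JustInf

namespace JustInf

/-! The system consists of quotients of `G` by a descending sequence of open normal subgroups, taken
from pairs `lower < upper` in which every closed normal subgroup properly inside `upper` lies in
`lower`. Two facts make it possible to continue such a sequence.

Obliquity (`finite_not_le`, `exists_open_le_or_le`): for `U` open there is an open normal `I` such
that each closed normal subgroup lies in `U` or contains `I`. This gives (ii) once the next `upper`
is placed inside `I`.

Small centralizers (`exists_chiefFactor_centralizer_le`): arbitrarily deep in `G` there are chief
factors in the class whose centralizer lies in a prescribed open subgroup. Otherwise obliquity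
yields an open normal `J` centralizing every deep chief factor in the class. Let `R` be minimal
among closed normal subgroups of `J` containing a term of the lower central series of `J`; it exists
because `G` is not virtually pronilpotent. Take a chief factor `K / L` in the class with `K ≤ R` of
least index. It is an elementary abelian `p`-group, central in `J`, and no chief factor between `K`
and `R` is in the class. Condition (*) then excludes all obstructions (order divisible by `p`, or
Schur multiplier divisible by `p`) to splitting `K / L` off `R`. The complement contains the next
lower central term, against the minimality of `R`. -/

theorem finite_setOf_ge {G : Type*} [Group G] (N : Subgroup G) [N.Normal] [N.FiniteIndex] :
    {X : Subgroup G | N ≤ X}.Finite :=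
  Set.finite_coe_iff.1 (Finite.of_equiv _ (QuotientGroup.comapMk'OrderIso N).toEquiv)

/-! ### Chain conditions and generalized obliquity in just infinite groups. -/

section JustInfinite

set_option linter.unusedSectionVars false

variable {G : Type u} [Group G] [TopologicalSpace G]

/-- Closed normal subgroups. -/
def IsClosedNormal (N : Subgroup G) : Prop :=
  N.Normal ∧ IsClosed (N : Set G)

variable [IsTopologicalGroup G] [CompactSpace G]

theorem finiteIndex_of_isOpen {N : Subgroup G} (h : IsOpen (N : Set G)) : N.FiniteIndex :=
  have := N.quotient_finite_of_isOpen h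
  Subgroup.finiteIndex_of_finite_quotient

theorem isClosedNormal_of_isOpen {N : Subgroup G} (hN : N.Normal) (h : IsOpen (N : Set G)) :
    IsClosedNormal N :=
  ⟨hN, N.isClosed_of_isOpen h⟩

namespace IsJustInfinite

theorem isOpen (hG : IsJustInfinite G) {N : Subgroup G} (hN : IsClosedNormal N) (h : N ≠ ⊥) :
    IsOpen (N : Set G) :=
  have := hG.finiteIndex N hN.1 hN.2 h
  N.isOpen_of_isClosed_of_finiteIndex hN.2

theorem isOpen_of_not_le (hG : IsJustInfinite G) {N U : Subgroup G} (hN : IsClosedNormal N)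
    (h : ¬ N ≤ U) : IsOpen (N : Set G) :=
  hG.isOpen hN (by rintro rfl; exact h bot_le)

theorem ne_bot (hG : IsJustInfinite G) {N : Subgroup G} (h : IsOpen (N : Set G)) : N ≠ ⊥ := by
  rintro rfl
  have := hG.infinite
  have := finiteIndex_of_isOpen h
  have h0 := Subgroup.FiniteIndex.index_ne_zero (H := (⊥ : Subgroup G))
  rw [Subgroup.index_bot] at h0
  exact h0 Nat.card_eq_zero_of_infinite

/-- If no term lay in `U`, compactness would put a point outside `U` in the intersection. The
intersection would then be nontrivial, so of finite index, with only finitely many subgroups above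
it. -/
theorem exists_le_of_strictAnti (hG : IsJustInfinite G) {N : ℕ → Subgroup G} (hN : StrictAnti N)
    (hc : ∀ i, IsClosedNormal (N i)) {U : Subgroup G} (hU : IsOpen (U : Set G)) :
    ∃ i, N i ≤ U := by
  by_contra! hcon
  have hcl : ∀ i, IsClosed ((N i : Set G) \ U) := fun i => (hc i).2.sdiff hU
  obtain ⟨x, hx⟩ := IsCompact.nonempty_iInter_of_directed_nonempty_isCompact_isClosed
    (fun i => (N i : Set G) \ U)
    (Antitone.directed_ge fun i j hij => Set.sdiff_subset_sdiff_left (hN.antitone hij))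
    (fun i => by
      obtain ⟨x, hx, hx'⟩ := SetLike.not_le_iff_exists.1 (hcon i)
      exact ⟨x, hx, hx'⟩)
    (fun i => (hcl i).isCompact) hcl
  rw [Set.mem_iInter] at hx
  have hJn : (⨅ i, N i).Normal := Subgroup.normal_iInf_normal fun i => (hc i).1
  have hJc : IsClosed ((⨅ i, N i : Subgroup G) : Set G) := by
    rw [Subgroup.coe_iInf]
    exact isClosed_iInter fun i => (hc i).2
  have hx' : x ∈ ⨅ i, N i := Subgroup.mem_iInf.2 fun i => (hx i).1
  have := hG.finiteIndex _ hJn hJc (by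
    intro h
    rw [h, Subgroup.mem_bot] at hx'
    exact (hx 0).2 (hx' ▸ U.one_mem))
  exact (Set.infinite_range_of_injective hN.injective)
    ((finite_setOf_ge (⨅ i, N i)).subset (by
      rintro _ ⟨i, rfl⟩
      exact iInf_le N i))

/-- Descending chain condition for closed normal subgroups outside `U`; it supplies the minimal
choices among closed normal subgroups below. -/
theorem exists_minimal (hG : IsJustInfinite G) {U : Subgroup G} (hU : IsOpen (U : Set G))
    {P : Subgroup G → Prop} (hP : ∀ N, P N → IsClosedNormal N ∧ ¬ N ≤ U) {N₀ : Subgroup G}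
    (h₀ : P N₀) : ∃ N, N ≤ N₀ ∧ Minimal P N := by
  have wf : WellFounded (fun M N : {N // P N} => M.1 < N.1) := by
    rw [wellFounded_iff_isEmpty_descending_chain]
    refine ⟨fun ⟨f, hf⟩ => ?_⟩
    obtain ⟨i, hi⟩ := hG.exists_le_of_strictAnti (N := fun i => (f i).1)
      (strictAnti_nat_of_succ_lt hf) (fun i => (hP _ (f i).2).1) hU
    exact (hP _ (f i).2).2 hi
  obtain ⟨N, hN, hmin⟩ := wf.has_min {N | N.1 ≤ N₀} ⟨⟨N₀, h₀⟩, le_refl N₀⟩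
  refine ⟨N.1, hN, N.2, fun M hM hMN => ?_⟩
  by_contra hNM
  exact hmin ⟨M, hM⟩ (hMN.trans hN) (lt_of_le_not_ge hMN hNM)

/-- Maximal elements among the closed normal subgroups of `G` properly contained in `H`. -/
def IsMaximalIn (H M : Subgroup G) : Prop :=
  Maximal (fun M => IsClosedNormal M ∧ M < H) M

theorem finite_isMaximalIn (hG : IsJustInfinite G) {H : Subgroup G} (hHn : H.Normal) :
    {M | IsMaximalIn H M}.Finite := by
  by_contra hinf
  have hnb : ∀ M, IsMaximalIn H M → M ≠ ⊥ := by
    rintro M hM rfl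
    refine hinf ((Set.finite_singleton ⊥).subset fun M' hM' => ?_)
    exact le_antisymm (hM.2 hM'.1 bot_le) bot_le
  have hop : ∀ M, IsMaximalIn H M → IsOpen (M : Set G) := fun M hM => hG.isOpen hM.1.1 (hnb M hM)
  obtain ⟨M₁, hM₁⟩ : {M | IsMaximalIn H M}.Nonempty := Set.Infinite.nonempty hinf
  have hHo : IsOpen (H : Set G) := Subgroup.isOpen_mono hM₁.1.2.le (hop _ hM₁)
  obtain ⟨N, hNH, hN⟩ := hG.exists_minimal (hop _ hM₁)
    (P := fun N => (IsClosedNormal N ∧ N ≤ H) ∧ ¬ N ≤ M₁) (fun N h => ⟨h.1.1, h.2⟩)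
    (N₀ := H) ⟨⟨isClosedNormal_of_isOpen hHn hHo, le_rfl⟩, hM₁.1.2.not_ge⟩
  have := hN.1.1.1.1
  have := hM₁.1.1.1
  have hXo : IsOpen ((N ⊓ M₁ : Subgroup G) : Set G) :=
    (hG.isOpen_of_not_le hN.1.1.1 hN.1.2).inter (hop _ hM₁)
  -- With `N` minimal subject to `¬ N ≤ M₁`, one open subgroup lies below every maximal `M`. If `M`
  -- were an exception, `N ⊓ M` would be proper in `N`, hence inside `M₁`, and the modular law would
  -- give `N = (N ⊓ M₁)(N ⊓ M) ≤ M₁`.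
  have key : ∀ M, IsMaximalIn H M → N ⊓ M₁ ≤ M := by
    intro M hM
    by_contra hXM
    have := hM.1.1.1
    have hNM : ¬ N ≤ M := fun h => hXM (inf_le_left.trans h)
    have hsup : (N ⊓ M₁) ⊔ M = H := by
      by_contra hne
      have hle : (N ⊓ M₁) ⊔ M ≤ H := sup_le (inf_le_left.trans hNH) hM.1.2.le
      exact hXM (le_sup_left.trans (hM.2 ⟨isClosedNormal_of_isOpen inferInstance
        (Subgroup.isOpen_mono le_sup_right (hop _ hM)), lt_of_le_of_ne hle hne⟩ le_sup_right))
    have hNM₁ : N ⊓ M ≤ M₁ := by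
      by_contra h
      have hle := hN.2 (y := N ⊓ M) ⟨⟨isClosedNormal_of_isOpen inferInstance
        ((hG.isOpen_of_not_le hN.1.1.1 hN.1.2).inter (hop _ hM)), inf_le_left.trans hNH⟩, h⟩
        inf_le_left
      exact hNM (hle.trans inf_le_right)
    refine hN.1.2 fun x hx => ?_
    have hx' : x ∈ (N ⊓ M₁) ⊔ M := hsup ▸ hNH hx
    obtain ⟨y, hy, z, hz, rfl⟩ := Subgroup.mem_sup_of_normal_right.1 hx'
    exact mul_mem hy.2 (hNM₁ ⟨(Subgroup.mul_mem_cancel_left _ hy.1).1 hx, hz⟩)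
  have := finiteIndex_of_isOpen hXo
  exact hinf ((finite_setOf_ge (N ⊓ M₁)).subset fun M hM => key M hM)

/-- Generalized obliquity: only finitely many closed normal subgroups of a just infinite group
are not contained in a given open subgroup. -/
theorem finite_not_le (hG : IsJustInfinite G) {U : Subgroup G} (hU : IsOpen (U : Set G)) :
    {N : Subgroup G | IsClosedNormal N ∧ ¬ N ≤ U}.Finite := by
  suffices h : ∀ H, IsClosedNormal H →
      {N : Subgroup G | (IsClosedNormal N ∧ ¬ N ≤ U) ∧ N ≤ H}.Finite by
    exact (h ⊤ ⟨inferInstance, isClosed_univ⟩).subset fun N hN => ⟨hN, le_top⟩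
  by_contra! hcon
  obtain ⟨H, hHc, hH⟩ := hcon
  -- A König argument: a minimal `H` with infinitely many such subgroups has finitely many maximal
  -- ones below it, and each of these contains only finitely many.
  obtain ⟨H, -, hmin⟩ := hG.exists_minimal hU (P := fun H => IsClosedNormal H ∧
    {N : Subgroup G | (IsClosedNormal N ∧ ¬ N ≤ U) ∧ N ≤ H}.Infinite) (fun H hH => ⟨hH.1, by
      obtain ⟨N, hN⟩ := hH.2.nonempty
      exact fun h => hN.1.2 (hN.2.trans h)⟩) ⟨hHc, hH⟩
  refine hmin.1.2 ((((hG.finite_isMaximalIn hmin.1.1.1).biUnion (t := fun M =>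
    {N : Subgroup G | (IsClosedNormal N ∧ ¬ N ≤ U) ∧ N ≤ M}) fun M hM => ?_).union
      (Set.finite_singleton H)).subset fun N hN => ?_)
  · by_contra hinf
    exact hM.1.2.not_ge (hmin.2 ⟨hM.1.1, hinf⟩ hM.1.2.le)
  · rcases eq_or_lt_of_le hN.2 with rfl | hlt
    · exact Or.inr rfl
    · left
      have hNo := hG.isOpen_of_not_le hN.1.1 hN.1.2
      have := hN.1.1.1
      have := finiteIndex_of_isOpen hNo
      obtain ⟨M, hNM, hM⟩ := ((finite_setOf_ge N).subset
        (t := {M | N ≤ M ∧ M.Normal ∧ M < H}) fun M h => h.1).exists_le_maximal (a := N)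
        ⟨le_rfl, hN.1.1.1, hlt⟩
      refine Set.mem_biUnion (x := M) ⟨⟨isClosedNormal_of_isOpen hM.1.2.1
        (Subgroup.isOpen_mono hNM hNo), hM.1.2.2⟩, fun M' hM' hle => ?_⟩ ⟨hN.1, hNM⟩
      exact hM.2 ⟨hNM.trans hle, hM'.1.1, hM'.2⟩ hle

theorem exists_open_le_or_le (hG : IsJustInfinite G) {U : Subgroup G} (hU : IsOpen (U : Set G)) :
    ∃ I : Subgroup G, I.Normal ∧ IsOpen (I : Set G) ∧
      ∀ N, IsClosedNormal N → N ≤ U ∨ I ≤ N := by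
  have hfin := hG.finite_not_le hU
  refine ⟨⨅ N : {N : Subgroup G | IsClosedNormal N ∧ ¬ N ≤ U}, N.1,
    Subgroup.normal_iInf_normal fun N => N.2.1.1, ?_, fun N hN => ?_⟩
  · rw [Subgroup.coe_iInf]
    have := hfin.to_subtype
    exact isOpen_iInter_of_finite fun N => hG.isOpen_of_not_le N.2.1 N.2.2
  · by_cases h : N ≤ U
    · exact Or.inl h
    · exact Or.inr (iInf_le (fun N : {N : Subgroup G | IsClosedNormal N ∧ ¬ N ≤ U} => N.1)
        ⟨N, hN, h⟩)

/-- If `K` is not inside `H`, there are finitely many choices for `K`. Then `L` is also outside `H`,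
or chiefness forces `L = K ⊓ H`, so only finitely many pairs occur. -/
theorem exists_chiefFactor_le (hG : IsJustInfinite G) {H : Subgroup G} (hHn : H.Normal)
    (hH : IsOpen (H : Set G)) {S : Set (ChiefFactor G)} (hS : S.Infinite) :
    ∃ F ∈ S, F.K ≤ H := by
  by_contra! hcon
  have hfin := hG.finite_not_le hH
  set T := {N : Subgroup G | IsClosedNormal N ∧ ¬ N ≤ H}
  refine hS (Set.Finite.of_finite_image (f := fun F : ChiefFactor G => (F.K, F.L))
    ((hfin.prod (hfin.union (hfin.image (· ⊓ H)))).subset ?_) ?_)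
  · rintro _ ⟨F, hF, rfl⟩
    have hK : F.K ∈ T := ⟨⟨F.normal_K, F.closed_K⟩, hcon F hF⟩
    refine ⟨hK, ?_⟩
    by_cases hL : F.L ≤ H
    · refine Or.inr ⟨F.K, hK, ?_⟩
      have := F.normal_K
      have hcl : IsClosed ((F.K ⊓ H : Subgroup G) : Set G) :=
        F.closed_K.inter (H.isClosed_of_isOpen hH)
      have := F.chief (F.K ⊓ H) inferInstance hcl
      by_contra hne
      refine this ⟨lt_of_le_of_ne (le_inf F.lt.le hL) (Ne.symm hne), lt_of_le_of_ne inf_le_left ?_⟩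
      exact fun h => hK.2 (inf_eq_left.1 h)
    · exact Or.inl ⟨⟨F.normal_L, F.closed_L⟩, hL⟩
  · intro F _ F' _ h
    exact ChiefFactor.ext (Prod.ext_iff.1 h).1 (Prod.ext_iff.1 h).2

end IsJustInfinite

end JustInfinite

/-! ### Central extensions of perfect groups and the Schur multiplier. -/

section Schur

open groupHomology Finsupp
open scoped IsMulCommutative

/-- The integers with trivial action of `S`, lifted to the universe of `S`. -/
noncomputable abbrev trivialInt (S : Type u) [Group S] : Rep (ULift.{u} ℤ) S :=
  Rep.trivial (ULift.{u} ℤ) S (ULift.{u} ℤ)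

theorem addHom_single_eq_zsmul {X : Type*} {A : Type*} [AddCommGroup A]
    (φ : (X →₀ ULift.{u} ℤ) →+ A) (x : X) (a : ULift.{u} ℤ) :
    φ (single x a) = a.down • φ (single x 1) := by
  rw [← map_zsmul, Finsupp.smul_single]
  congr 2
  ext
  simp

theorem exists_addHom_single_eq {X : Type*} {A : Type*} [AddCommGroup A] (f : X → X → A) :
    ∃ φ : (X × X →₀ ULift.{u} ℤ) →+ A, ∀ x y, φ (single (x, y) 1) = f x y :=
  ⟨Finsupp.liftAddHom fun x => (zmultiplesHom _ (f x.1 x.2)).comp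
    (AddEquiv.ulift : ULift.{u} ℤ ≃+ ℤ).toAddMonoidHom, fun x y => by
      rw [Finsupp.liftAddHom_apply_single]
      exact one_zsmul _⟩

variable {S : Type u} [Group S]

/-- A homomorphism on 2-chains which kills boundaries and is killed by a prime not dividing the
order of the Schur multiplier kills cycles. -/
theorem apply_eq_zero_of_mem_cycles₂ {A : Type*} [AddCommGroup A] {p : ℕ} (hp : p.Prime)
    (hS : ¬ p ∣ Nat.card (SchurMultiplier S)) (φ : (S × S →₀ ULift.{u} ℤ) →+ A)
    (hφp : ∀ y, p • φ y = 0)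
    (hφ : ∀ g h k : S, φ (single (h, k) 1) - φ (single (g * h, k) 1) + φ (single (g, h * k) 1)
      - φ (single (g, h) 1) = 0)
    (y : S × S →₀ ULift.{u} ℤ) (hy : y ∈ cycles₂ (trivialInt S)) : φ y = 0 := by
  have hb : ∀ x ∈ boundaries₂ (trivialInt S), φ x = 0 := by
    rintro _ ⟨x, rfl⟩
    induction x using Finsupp.induction_linear with
    | zero => simp
    | add x y hx hy => rw [map_add, map_add, hx, hy, add_zero]
    | single g a =>
      change φ (d₃₂ (trivialInt S) (single g a)) = 0
      rw [d₃₂_single]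
      change φ (single (g.2.1, g.2.2) a - single (g.1 * g.2.1, g.2.2) a +
        single (g.1, g.2.1 * g.2.2) a - single (g.1, g.2.1) a) = 0
      rw [map_sub, map_add, map_sub, addHom_single_eq_zsmul φ (g.2.1, g.2.2),
        addHom_single_eq_zsmul φ (g.1 * g.2.1, g.2.2),
        addHom_single_eq_zsmul φ (g.1, g.2.1 * g.2.2), addHom_single_eq_zsmul φ (g.1, g.2.1),
        ← smul_sub, ← smul_add, ← smul_sub, hφ, smul_zero]
  -- `φ y` is killed by both `p` and the order of the multiplier. An infinite multiplier has
  -- `Nat.card` equal to `0`, which `p` divides, so `hS` excludes it.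
  have hn : Nat.card (SchurMultiplier S) • H2π (trivialInt S) ⟨y, hy⟩ = 0 := card_nsmul_eq_zero'
  rw [← map_nsmul, H2π_eq_zero_iff] at hn
  have h2 : Nat.card (SchurMultiplier S) • φ y = 0 := by
    rw [← map_nsmul]
    exact hb _ hn
  have h3 : addOrderOf (φ y) ∣ 1 := by
    rw [← (Nat.Prime.coprime_iff_not_dvd hp).2 hS]
    exact Nat.dvd_gcd (addOrderOf_dvd_of_nsmul_eq_zero (hφp y)) (addOrderOf_dvd_of_nsmul_eq_zero h2)
  simpa using h3

/-- Modulo boundaries, `g ↦ [g]` is a homomorphism to an abelian group, hence trivial on a perfect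
group. -/
theorem exists_d₂₁_eq_single (hS : commutator S = ⊤) (g : S) :
    ∃ y : S × S →₀ ULift.{u} ℤ, d₂₁ (trivialInt S) y = single g 1 := by
  let q := Submodule.mkQ (LinearMap.range (d₂₁ (trivialInt S)).hom)
  let f : S →* Multiplicative ((S →₀ ULift.{u} ℤ) ⧸ LinearMap.range (d₂₁ (trivialInt S)).hom) :=
    MonoidHom.mk' (fun g => Multiplicative.ofAdd (q (single g 1))) fun g h => by
      rw [← ofAdd_add, ← map_add]
      congr 1
      rw [← sub_eq_zero, ← map_sub, ← neg_eq_zero, ← map_neg]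
      refine (Submodule.Quotient.mk_eq_zero _).2 ⟨single (g, h) 1, ?_⟩
      change d₂₁ (trivialInt S) (single (g, h) 1) = _
      rw [d₂₁_single]
      change single h 1 - single (g * h) 1 + single g 1 = _
      abel
  have hf : g ∈ f.ker := Abelianization.commutator_subset_ker f (hS ▸ Subgroup.mem_top g)
  have : q (single g 1) = 0 := hf
  obtain ⟨y, hy⟩ := (Submodule.Quotient.mk_eq_zero _).1 this
  exact ⟨y, hy⟩

/-- If `S` is perfect and `p` does not divide the order of its Schur multiplier, then central
extensions of `S` by groups of exponent `p` split. -/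
theorem commutator_inf_ker_eq_bot {E : Type*} [Group E] (π : E →* S)
    (hπ : Function.Surjective π) (hZ : π.ker ≤ Subgroup.center E) {p : ℕ} (hp : p.Prime)
    (hker : ∀ z ∈ π.ker, z ^ p = 1) (hperf : commutator S = ⊤)
    (hS : ¬ p ∣ Nat.card (SchurMultiplier S)) : commutator E ⊓ π.ker = ⊥ := by
  obtain ⟨s, hs⟩ := hπ.hasRightInverse
  have hc (e : E) : e * (s (π e))⁻¹ ∈ π.ker := by simp [MonoidHom.mem_ker, hs (π e)]
  have hfk (g h : S) : s g * s h * (s (g * h))⁻¹ ∈ π.ker := by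
    simp [MonoidHom.mem_ker, hs g, hs h, hs (g * h)]
  -- The factor set of the section `s`; the cocycle identity says that its linear extension `φ`
  -- kills boundaries.
  let f : S → S → Additive (Subgroup.center E) := fun g h =>
    Additive.ofMul ⟨s g * s h * (s (g * h))⁻¹, hZ (hfk g h)⟩
  obtain ⟨φ, hφs⟩ := exists_addHom_single_eq f
  have hφp (y) : p • φ y = 0 := by
    induction y using Finsupp.induction_linear with
    | zero => simp
    | add x y hx hy => rw [map_add, smul_add, hx, hy, add_zero]
    | single g a =>
      rw [addHom_single_eq_zsmul φ, hφs, smul_comm]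
      have : p • f g.1 g.2 = 0 := by
        apply Additive.toMul.injective
        exact Subtype.ext (hker _ (hfk g.1 g.2))
      rw [this, smul_zero]
  have hcomm (g h : S) (e : E) : e * (s g * s h * (s (g * h))⁻¹) =
      (s g * s h * (s (g * h))⁻¹) * e := (Subgroup.mem_center_iff.1 (hZ (hfk g h)) e)
  have hφ := apply_eq_zero_of_mem_cycles₂ hp hS φ hφp fun g h k => by
    rw [hφs, hφs, hφs, hφs, sub_eq_zero, sub_add_eq_add_sub, sub_eq_iff_eq_add]
    apply Additive.toMul.injective
    refine Subtype.ext ?_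
    change s h * s k * (s (h * k))⁻¹ * (s g * s (h * k) * (s (g * (h * k)))⁻¹) =
      s g * s h * (s (g * h))⁻¹ * (s (g * h) * s k * (s (g * h * k))⁻¹)
    rw [← mul_assoc, ← mul_assoc, ← hcomm h k (s g), mul_assoc g h k]
    group
  choose y hy using exists_d₂₁_eq_single hperf
  let ψ (g : S) : Additive (Subgroup.center E) := φ (y g)
  -- The difference of the chains involved is a cycle, so `φ` kills it and `f` is a coboundary.
  have hψ (g h : S) : f g h = ψ g + ψ h - ψ (g * h) := by
    rw [← hφs, ← map_add, ← map_sub, ← sub_eq_zero, ← map_sub]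
    apply hφ
    change d₂₁ (trivialInt S) _ = 0
    rw [map_sub, map_sub, map_add, hy, hy, hy, d₂₁_single]
    change single h 1 - single (g * h) 1 + single g 1 - _ = 0
    abel
  let c : E → Additive (Subgroup.center E) := fun e => Additive.ofMul ⟨e * (s (π e))⁻¹, hZ (hc e)⟩
  have hcm (e e' : E) : c (e * e') = c e + c e' + f (π e) (π e') := by
    apply Additive.toMul.injective
    refine Subtype.ext ?_
    change e * e' * (s (π (e * e')))⁻¹ = e * (s (π e))⁻¹ * (e' * (s (π e'))⁻¹) *
      (s (π e) * s (π e') * (s (π e * π e'))⁻¹)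
    have := Subgroup.mem_center_iff.1 (hZ (hc e')) (s (π e))⁻¹
    rw [mul_assoc e (s (π e))⁻¹, this, map_mul]
    group
  -- Correcting by `ψ` turns `c` into a homomorphism to an abelian group that is the identity on
  -- `π.ker`, so it kills commutators yet detects the kernel.
  let r : E →* Multiplicative (Additive (Subgroup.center E)) :=
    MonoidHom.mk' (fun e => Multiplicative.ofAdd (c e + ψ (π e))) fun e e' => by
      rw [← ofAdd_add, hcm, hψ, map_mul]
      congr 1
      abel
  refine (Subgroup.eq_bot_iff_forall _).2 fun z hz => ?_
  have hr : c z + ψ (π z) = 0 := Abelianization.commutator_subset_ker r hz.1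
  have hz2 : π z = 1 := hz.2
  -- The section need not satisfy `s 1 = 1`; `ψ 1 = f 1 1` is the factor `s 1` that compensates.
  have h11 := hψ 1 1
  rw [mul_one, add_sub_cancel_right] at h11
  rw [hz2, ← h11] at hr
  have := congrArg (fun x => ((Additive.toMul x : Subgroup.center E) : E)) hr
  change z * (s (π z))⁻¹ * (s 1 * s 1 * (s (1 * 1))⁻¹) = 1 at this
  simpa [hz2] using this

end Schur
-- Characteristically simple groups and characteristic complements to central kernels.
section CharacteristicallySimple

open scoped commutatorElement

variable {W : Type u} [Group W]

theorem IsCharacteristicallySimple.center_eq_bot (hW : IsCharacteristicallySimple W)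
    (hna : ¬ ∀ x y : W, x * y = y * x) : Subgroup.center W = ⊥ :=
  (hW.2 _ inferInstance).resolve_right fun h => hna fun x y =>
    (Subgroup.mem_center_iff.1 (h ▸ Subgroup.mem_top y) x)

/-- A nonabelian finite characteristically simple group is an internal direct product of copies
of a perfect simple subgroup. -/
theorem IsCharacteristicallySimple.exists_decomposition [Finite W]
    (hW : IsCharacteristicallySimple W) (hna : ¬ ∀ x y : W, x * y = y * x) :
    ∃ (ι : Type u) (_ : Fintype ι) (H : ι → Subgroup W) (S : Subgroup W), Nonempty ι ∧
      IsSimpleGroup S ∧ commutator S = ⊤ ∧ (∀ i, Nonempty (H i ≃* S)) ∧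
      (Pairwise fun i j => ∀ x y : W, x ∈ H i → y ∈ H j → Commute x y) ∧
      iSupIndep H ∧ ⨆ i, H i = ⊤ := by
  have := hW.1
  have hZ := hW.center_eq_bot hna
  obtain ⟨S, hS⟩ := (Set.toFinite {N : Subgroup W | N.Normal ∧ N ≠ ⊥}).exists_minimal
    ⟨⊤, inferInstance, top_ne_bot⟩
  have hSn := hS.1.1
  -- The factors are the distinct images of one minimal normal subgroup under automorphisms; their
  -- join is characteristic.
  let ι := {H : Subgroup W // ∃ φ : W ≃* W, S.map φ.toMonoidHom = H}
  let H : ι → Subgroup W := fun i => i.1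
  have : Fintype ι := Fintype.ofFinite ι
  have hmin (i : ι) : Minimal (fun N : Subgroup W => N.Normal ∧ N ≠ ⊥) (H i) := by
    obtain ⟨-, φ, rfl⟩ := i
    refine ⟨⟨hSn.map _ φ.surjective, fun h => hS.1.2 ?_⟩, fun N hN hle => ?_⟩
    · exact (Subgroup.map_eq_bot_iff_of_injective _ φ.injective).1 h
    · have hc : S ≤ N.comap φ.toMonoidHom := by
        refine hS.2 ⟨hN.1.comap _, fun h => hN.2 ?_⟩ ?_
        · rw [← Subgroup.map_comap_eq_self_of_surjective (f := φ.toMonoidHom) φ.surjective N, h,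
            Subgroup.map_bot]
        · rw [← Subgroup.comap_map_eq_self_of_injective (f := φ.toMonoidHom) φ.injective S]
          exact Subgroup.comap_mono hle
      exact Subgroup.map_le_iff_le_comap.2 hc
  have hn (i : ι) : (H i).Normal := (hmin i).1.1
  have hcomm : Pairwise fun i j => ∀ x y : W, x ∈ H i → y ∈ H j → Commute x y := by
    intro i j hij
    refine Subgroup.commute_of_normal_of_disjoint _ _ (hn i) (hn j) (disjoint_iff.2 ?_)
    by_contra hne
    have := hn i
    have := hn j
    have h1 := (hmin i).2 (y := H i ⊓ H j) ⟨inferInstance, hne⟩ inf_le_left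
    have h2 := (hmin j).2 (y := H i ⊓ H j) ⟨inferInstance, hne⟩ inf_le_right
    exact hij (Subtype.ext (le_antisymm (h1.trans inf_le_right) (h2.trans inf_le_left)))
  have htop : ⨆ i, H i = ⊤ := by
    refine (hW.2 _ ?_).resolve_left fun h => ?_
    · rw [Subgroup.characteristic_iff_map_le]
      intro ψ
      rw [Subgroup.map_iSup]
      refine iSup_le fun i => ?_
      obtain ⟨K, φ, rfl⟩ := i
      refine le_of_eq_of_le ?_ (le_iSup H ⟨_, φ.trans ψ, rfl⟩)
      change (S.map φ.toMonoidHom).map ψ.toMonoidHom = S.map (φ.trans ψ).toMonoidHom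
      rw [Subgroup.map_map]
      rfl
    · have h1 : S ≤ ⨆ i, H i := le_of_eq_of_le (by
        change S = S.map (MulEquiv.refl W).toMonoidHom
        exact (Subgroup.map_id S).symm) (le_iSup H ⟨_, MulEquiv.refl W, rfl⟩)
      exact hS.1.2 (le_bot_iff.1 (h ▸ h1))
  have hcent (i : ι) {x : W} (hx : x ∈ H i) (hx' : ∀ y ∈ H i, Commute x y) : x = 1 := by
    have hle : ⨆ j, H j ≤ Subgroup.centralizer {x} := by
      refine iSup_le fun j y hy => Subgroup.mem_centralizer_iff.2 fun z hz => ?_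
      rw [Set.mem_singleton_iff.1 hz]
      rcases eq_or_ne i j with rfl | hij
      · exact hx' y hy
      · exact hcomm hij x y hx hy
    have : x ∈ Subgroup.center W := by
      rw [Subgroup.mem_center_iff]
      intro g
      exact (Subgroup.mem_centralizer_iff.1 (hle (htop ▸ Subgroup.mem_top g)) x rfl).symm
    rwa [hZ, Subgroup.mem_bot] at this
  have hind : iSupIndep H := by
    intro i
    rw [disjoint_iff, Subgroup.eq_bot_iff_forall]
    rintro x ⟨hx, hx'⟩
    refine hcent i hx fun y hy => ?_
    have hle : ⨆ j, ⨆ (_ : j ≠ i), H j ≤ Subgroup.centralizer {y} := by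
      refine iSup₂_le fun j hj z hz => Subgroup.mem_centralizer_iff.2 fun y' hy' => ?_
      rw [Set.mem_singleton_iff.1 hy']
      exact hcomm hj.symm y z hy hz
    exact (Subgroup.mem_centralizer_iff.1 (hle hx') y rfl).symm
  let i₀ : ι := ⟨S, MulEquiv.refl W, Subgroup.map_id S⟩
  have hSnt : Nontrivial S := (Subgroup.nontrivial_iff_ne_bot S).2 hS.1.2
  have hsimple : IsSimpleGroup S := by
    refine ⟨fun N hN => ?_⟩
    -- A normal subgroup of one factor is centralized by the others, so it is normal in `W` and
    -- minimality of `S` applies.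
    have hle : ⨆ j, H j ≤ Subgroup.normalizer (N.map S.subtype : Set W) := by
      refine iSup_le fun j => ?_
      rcases eq_or_ne i₀ j with rfl | hij
      · intro s hs
        rw [Subgroup.mem_normalizer_iff]
        have key : ∀ s : S, ∀ h : W, h ∈ N.map S.subtype →
            s.1 * h * s.1⁻¹ ∈ N.map S.subtype := by
          rintro s _ ⟨n, hn, rfl⟩
          exact ⟨s * n * s⁻¹, hN.conj_mem n hn s, rfl⟩
        refine fun h => ⟨key ⟨s, hs⟩ h, fun hh => ?_⟩
        have := key ⟨s, hs⟩⁻¹ _ hh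
        simpa [mul_assoc] using this
      · refine le_trans (fun y hy => ?_) (Subgroup.centralizer_le_normalizer _)
        rw [Subgroup.mem_centralizer_iff]
        rintro _ ⟨n, hn, rfl⟩
        exact hcomm hij _ y n.2 hy
    have hNn : (N.map S.subtype).Normal :=
      Subgroup.normalizer_eq_top_iff.1 (top_le_iff.1 (htop ▸ hle))
    by_cases hb : N.map S.subtype = ⊥
    · exact Or.inl ((Subgroup.map_eq_bot_iff_of_injective _ S.subtype_injective).1 hb)
    · right
      have h := hS.2 ⟨hNn, hb⟩ (Subgroup.map_subtype_le N)
      rw [eq_top_iff]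
      intro s _
      obtain ⟨n, hn, hns⟩ := h s.2
      rwa [← Subtype.ext hns]
  have hperf : commutator S = ⊤ := by
    refine (hsimple.eq_bot_or_eq_top_of_normal _ inferInstance).resolve_left fun h => ?_
    rw [commutator_eq_bot_iff_center_eq_top] at h
    obtain ⟨x, hx⟩ := exists_ne (1 : S)
    refine hx (Subtype.ext (hcent i₀ x.2 fun y hy => ?_))
    have := Subgroup.mem_center_iff.1 (h ▸ Subgroup.mem_top x) ⟨y, hy⟩
    exact (congrArg Subtype.val this).symm
  refine ⟨ι, this, H, S, ⟨i₀⟩, hsimple, hperf, fun i => ?_, hcomm, hind, htop⟩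
  obtain ⟨-, φ, rfl⟩ := i
  exact ⟨(S.equivMapOfInjective φ.toMonoidHom φ.injective).symm⟩

/-- A group which is the internal direct product of copies of `S` is a power of `S`. -/
theorem nonempty_mulEquiv_pi {ι : Type*} [Fintype ι] {H : ι → Subgroup W} {S : Type*} [Group S]
    (hS : ∀ i, Nonempty (H i ≃* S))
    (hcomm : Pairwise fun i j => ∀ x y : W, x ∈ H i → y ∈ H j → Commute x y)
    (hind : iSupIndep H) (htop : ⨆ i, H i = ⊤) :
    Nonempty ((Fin (Fintype.card ι) → S) ≃* W) := by
  have hsurj : Function.Surjective (Subgroup.noncommPiCoprod hcomm) := by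
    rw [← MonoidHom.range_eq_top, Subgroup.noncommPiCoprod_range, htop]
  have e₁ := MulEquiv.ofBijective (Subgroup.noncommPiCoprod hcomm)
    ⟨Subgroup.injective_noncommPiCoprod_of_iSupIndep hind, hsurj⟩
  have e₂ := MulEquiv.piCongrRight fun i => (hS i).some
  have e₃ : (Fin (Fintype.card ι) → S) ≃* (ι → S) :=
    MulEquiv.arrowCongr (Fintype.equivFin ι).symm (MulEquiv.refl S)
  exact ⟨e₃.trans (e₂.symm.trans e₁)⟩

/-- Central extensions by groups of exponent `p` of a product of copies of a perfect group whose
Schur multiplier has order prime to `p`. -/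
theorem commutator_inf_ker_eq_bot_of_pi {E : Type*} [Group E] (π : E →* W)
    (hπ : Function.Surjective π) (hZ : π.ker ≤ Subgroup.center E) {p : ℕ} (hp : p.Prime)
    (hker : ∀ z ∈ π.ker, z ^ p = 1) {S : Type u} [Group S] (hperf : commutator S = ⊤)
    (hS : ¬ p ∣ Nat.card (SchurMultiplier S)) {ι : Type*} [Fintype ι] {H : ι → Subgroup W}
    (hHS : ∀ i, Nonempty (H i ≃* S))
    (hcomm : Pairwise fun i j => ∀ x y : W, x ∈ H i → y ∈ H j → Commute x y)
    (hind : iSupIndep H) (htop : ⨆ i, H i = ⊤) :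
    commutator E ⊓ π.ker = ⊥ ∧ commutator E ⊔ π.ker = ⊤ := by
  let X (i : ι) : Subgroup E := (H i).comap π
  -- `D i` is a lift of `H i` meeting the kernel trivially, by the case of a single factor. The
  -- lifts commute pairwise, and their join is both the complement and `commutator E`.
  let D (i : ι) : Subgroup E := ⁅X i, X i⁆
  have hXH (i : ι) : (X i).map π = H i := Subgroup.map_comap_eq_self_of_surjective hπ _
  have hDH (i : ι) : (D i).map π = H i := by
    rw [Subgroup.map_commutator, hXH, ← Subgroup.map_subtype_commutator]
    have e := (hHS i).some
    have : commutator (H i) = ⊤ := by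
      have := Subgroup.map_commutator (⊤ : Subgroup S) ⊤ e.symm.toMonoidHom
      have hm : (⊤ : Subgroup S).map e.symm.toMonoidHom = ⊤ :=
        Subgroup.map_top_of_surjective _ e.symm.surjective
      rw [hm, ← commutator_def, hperf, hm] at this
      exact this.symm
    rw [this, ← MonoidHom.range_eq_map, Subgroup.range_subtype]
  have hDker (i : ι) : D i ⊓ π.ker = ⊥ := by
    have e := (hHS i).some
    let ρ : X i →* S := e.toMonoidHom.comp (π.subgroupComap (H i))
    have hρ : ∀ x : X i, x ∈ ρ.ker ↔ x.1 ∈ π.ker := by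
      intro x
      rw [MonoidHom.mem_ker, MonoidHom.mem_ker]
      change e (π.subgroupComap (H i) x) = 1 ↔ _
      rw [map_eq_one_iff e e.injective]
      exact Subtype.ext_iff
    have := commutator_inf_ker_eq_bot ρ
      (e.surjective.comp (π.subgroupComap_surjective_of_surjective (H i) hπ))
      (fun x hx => Subgroup.mem_center_iff.2 fun g => Subtype.ext
        (Subgroup.mem_center_iff.1 (hZ ((hρ x).1 hx)) g)) hp
      (fun x hx => Subtype.ext (hker x ((hρ x).1 hx))) hperf hS
    rw [Subgroup.eq_bot_iff_forall]
    rintro x ⟨hx, hx'⟩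
    change x ∈ ⁅X i, X i⁆ at hx
    rw [← Subgroup.map_subtype_commutator] at hx
    obtain ⟨y, hy, rfl⟩ := hx
    have hy' : y ∈ commutator (X i) ⊓ ρ.ker := ⟨hy, (hρ y).2 hx'⟩
    rw [this, Subgroup.mem_bot] at hy'
    rw [hy', map_one]
  have hDD : Pairwise fun i j => ∀ x y : E, x ∈ D i → y ∈ D j → Commute x y := by
    intro i j hij x y hx hy
    have hXX : ⁅X i, X j⁆ ≤ π.ker := by
      rw [Subgroup.commutator_le]
      intro a ha b hb
      rw [MonoidHom.mem_ker, map_commutatorElement, commutatorElement_eq_one_iff_commute]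
      exact hcomm hij _ _ ha hb
    have h0 : ⁅⁅X i, X j⁆, X i⁆ = ⊥ := by
      rw [Subgroup.commutator_eq_bot_iff_le_centralizer]
      intro z hz
      rw [Subgroup.mem_centralizer_iff]
      intro g _
      exact Subgroup.mem_center_iff.1 (hZ (hXX hz)) g
    -- Three subgroups lemma: `⁅X i, X j⁆` lies in the central kernel.
    have h1 : ⁅⁅X i, X i⁆, X j⁆ = ⊥ := by
      refine Subgroup.commutator_commutator_eq_bot_of_rotate h0 ?_
      rw [Subgroup.commutator_comm (X j)]
      exact h0
    have h2 := (Subgroup.commutator_eq_bot_iff_le_centralizer.1 h1) hx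
    exact (Subgroup.mem_centralizer_iff.1 h2 y
      (Subgroup.commutator_le.2 (fun a ha b hb =>
        mul_mem (mul_mem (mul_mem ha hb) (inv_mem ha)) (inv_mem hb)) hy)).symm
  have hDtop : (⨆ i, D i).map π = ⊤ := by
    rw [Subgroup.map_iSup, ← htop]
    exact iSup_congr hDH
  have hDbot : (⨆ i, D i) ⊓ π.ker = ⊥ := by
    rw [Subgroup.eq_bot_iff_forall]
    rintro x ⟨hx, hx'⟩
    rw [← Subgroup.noncommPiCoprod_range (hcomm := hDD)] at hx
    obtain ⟨d, rfl⟩ := hx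
    let h : ∀ i, H i := fun i => ⟨π (d i), hDH i ▸ Subgroup.mem_map_of_mem π (d i).2⟩
    have hh : Subgroup.noncommPiCoprod hcomm h = 1 := by
      rw [← MonoidHom.mem_ker.1 hx', Subgroup.noncommPiCoprod_apply,
        Subgroup.noncommPiCoprod_apply]
      exact (Finset.map_noncommProd _ _ _ π).symm
    have hh' : h = 1 := Subgroup.injective_noncommPiCoprod_of_iSupIndep hind
      (hh.trans (map_one _).symm)
    have hd : d = 1 := by
      funext i
      have : (d i).1 ∈ D i ⊓ π.ker := ⟨(d i).2, congrArg Subtype.val (congrFun hh' i)⟩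
      rw [hDker, Subgroup.mem_bot] at this
      exact Subtype.ext this
    rw [hd, map_one]
  have hfac : ∀ e : E, ∃ d ∈ ⨆ i, D i, ∃ z ∈ Subgroup.center E, e = d * z := by
    intro e
    obtain ⟨d, hd, hde⟩ : π e ∈ (⨆ i, D i).map π := hDtop ▸ Subgroup.mem_top _
    refine ⟨d, hd, d⁻¹ * e, hZ ?_, by group⟩
    rw [MonoidHom.mem_ker, map_mul, map_inv, hde, inv_mul_cancel]
  have hle : commutator E ≤ ⨆ i, D i := by
    rw [commutator_def, Subgroup.commutator_le]
    intro a _ b _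
    obtain ⟨d, hd, z, hz, rfl⟩ := hfac a
    obtain ⟨d', hd', z', hz', rfl⟩ := hfac b
    have : ⁅d * z, d' * z'⁆ = ⁅d, d'⁆ := by
      rw [Subgroup.mem_center_iff] at hz hz'
      have e1 : ∀ g : E, z * g * z⁻¹ = g := fun g => by rw [← hz g, mul_inv_cancel_right]
      have e2 : ∀ g : E, z' * g * z'⁻¹ = g := fun g => by rw [← hz' g, mul_inv_cancel_right]
      calc ⁅d * z, d' * z'⁆ = d * (z * (d' * z') * z⁻¹) * d⁻¹ * (z'⁻¹ * d'⁻¹) := by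
            rw [commutatorElement_def]; group
        _ = d * d' * (z' * d⁻¹ * z'⁻¹) * d'⁻¹ := by rw [e1]; group
        _ = ⁅d, d'⁆ := by rw [e2, commutatorElement_def]
    rw [this]
    exact mul_mem (mul_mem (mul_mem hd hd') (inv_mem hd)) (inv_mem hd')
  have hge : ⨆ i, D i ≤ commutator E :=
    iSup_le fun i => Subgroup.commutator_mono le_top le_top
  refine ⟨le_bot_iff.1 (hDbot ▸ inf_le_inf_right _ hle), eq_top_iff.2 fun e _ => ?_⟩
  obtain ⟨d, hd, hde⟩ : π e ∈ (⨆ i, D i).map π := hDtop ▸ Subgroup.mem_top _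
  have : e = d * (d⁻¹ * e) := by group
  rw [this]
  refine Subgroup.mul_mem_sup (hge hd) ?_
  rw [MonoidHom.mem_ker, map_mul, map_inv, hde, inv_mul_cancel]

theorem IsCharacteristicallySimple.isElementaryAbelian [Finite W]
    (hW : IsCharacteristicallySimple W) (hcomm : ∀ x y : W, x * y = y * x) {p : ℕ}
    (hp : p.Prime) (hdvd : p ∣ Nat.card W) : IsElementaryAbelian p W := by
  have : Fact p.Prime := ⟨hp⟩
  let T : Subgroup W :=
    { carrier := {x | x ^ p = 1}
      one_mem' := one_pow p
      mul_mem' := fun {x y} hx hy => by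
        rw [Set.mem_ofPred_eq] at *
        rw [(show Commute x y from hcomm x y).mul_pow, hx, hy, one_mul]
      inv_mem' := fun {x} hx => by
        rw [Set.mem_ofPred_eq] at *
        rw [inv_pow, hx, inv_one] }
  refine ⟨inferInstance, hW.1, hcomm, fun x => ?_⟩
  have hT : T.Characteristic := by
    rw [Subgroup.characteristic_iff_map_le]
    rintro φ _ ⟨x, hx, rfl⟩
    change (φ x) ^ p = 1
    rw [← map_pow, show x ^ p = 1 from hx, map_one]
  rcases hW.2 T hT with h | h
  · obtain ⟨x, hx⟩ := exists_prime_orderOf_dvd_card' p hdvd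
    have : x ∈ T := by
      change x ^ p = 1
      rw [← hx, pow_orderOf_eq_one]
    rw [h, Subgroup.mem_bot] at this
    rw [this, orderOf_one] at hx
    exact absurd hx.symm hp.one_lt.ne'
  · exact (h ▸ Subgroup.mem_top x : x ∈ T)

/-- Schur–Zassenhaus gives a complement. As the kernel is central of exponent `p`, the complement is
the set of solutions of `x ^ |W| = 1`, hence characteristic. -/
theorem exists_characteristic_complement_of_coprime {E : Type*} [Group E] [Finite E]
    (π : E →* W) (hπ : Function.Surjective π) (hZ : π.ker ≤ Subgroup.center E) {p : ℕ}
    (hp : p.Prime) (hker : ∀ z ∈ π.ker, z ^ p = 1) (hndvd : ¬ p ∣ Nat.card W) :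
    ∃ Y : Subgroup E, Y.Characteristic ∧ Y ⊓ π.ker = ⊥ ∧ Y ⊔ π.ker = ⊤ := by
  have : Fact p.Prime := ⟨hp⟩
  have hpg : IsPGroup p π.ker := fun z => ⟨1, Subtype.ext (by simpa using hker z z.2)⟩
  obtain ⟨n, hn⟩ := IsPGroup.iff_card.1 hpg
  have hind : π.ker.index = Nat.card W := by
    rw [Subgroup.index_ker, MonoidHom.range_eq_top.2 hπ, Subgroup.card_top]
  have hcop : (p ^ n).Coprime (Nat.card W) :=
    Nat.Coprime.pow_left n ((Nat.Prime.coprime_iff_not_dvd hp).2 hndvd)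
  obtain ⟨Q, hQ⟩ := Subgroup.exists_right_complement'_of_coprime (N := π.ker) (by rwa [hn, hind])
  have hQc : Nat.card Q = Nat.card W := by rw [← hind, hQ.symm.index_eq_card]
  have hmem : ∀ x, x ∈ Q ↔ x ^ Nat.card W = 1 := by
    refine fun x => ⟨fun hx => ?_, fun hx => ?_⟩
    · have := pow_card_eq_one' (x := (⟨x, hx⟩ : Q))
      rw [hQc] at this
      exact congrArg Subtype.val this
    · obtain ⟨z, hz, q, hq, rfl⟩ := Subgroup.mem_sup_of_normal_left.1
        (hQ.sup_eq_top ▸ Subgroup.mem_top x : x ∈ π.ker ⊔ Q)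
      have hzq : Commute z q := ((Subgroup.mem_center_iff.1 (hZ hz)) q).symm
      have hq' : q ^ Nat.card W = 1 := by
        have := pow_card_eq_one' (x := (⟨q, hq⟩ : Q))
        rw [hQc] at this
        exact congrArg Subtype.val this
      rw [hzq.mul_pow, hq', mul_one] at hx
      have h1 : orderOf z ∣ 1 := by
        rw [← (Nat.Prime.coprime_iff_not_dvd hp).2 hndvd]
        exact Nat.dvd_gcd (orderOf_dvd_of_pow_eq_one (hker z hz)) (orderOf_dvd_of_pow_eq_one hx)
      rw [orderOf_eq_one_iff.1 (Nat.dvd_one.1 h1), one_mul]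
      exact hq
  refine ⟨Q, ?_, ?_, by rw [sup_comm, hQ.sup_eq_top]⟩
  · rw [Subgroup.characteristic_iff_map_le]
    rintro φ _ ⟨x, hx, rfl⟩
    rw [hmem]
    change (φ x) ^ _ = 1
    rw [← map_pow, (hmem x).1 hx, map_one]
  · rw [inf_comm]
    exact disjoint_iff.1 hQ.disjoint

/-- Condition (*) enters here: a quotient outside the class is either abelian of order prime to `p`,
or a power of a nonabelian simple group whose multiplier has order prime to `p`. The complement must
be characteristic so that its preimage is normal in the ambient group. -/
theorem FiniteGroupClass.Star.exists_characteristic_complement {C : FiniteGroupClass.{u}}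
    (hC : C.Star) {p : ℕ} (hp : p.Prime)
    (hCp : ∃ (H : Type u) (_ : Group H), C.Mem H ∧ IsElementaryAbelian p H)
    {E : Type*} [Group E] [Finite E] (π : E →* W) (hπ : Function.Surjective π)
    (hZ : π.ker ≤ Subgroup.center E) (hker : ∀ z ∈ π.ker, z ^ p = 1)
    (hW : IsCharacteristicallySimple W) (hWC : ¬ C.Mem W) :
    ∃ Y : Subgroup E, Y.Characteristic ∧ Y ⊓ π.ker = ⊥ ∧ Y ⊔ π.ker = ⊤ := by
  have : Finite W := Finite.of_surjective π hπ
  by_cases hcomm : ∀ x y : W, x * y = y * x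
  · refine exists_characteristic_complement_of_coprime π hπ hZ hp hker fun hdvd => hWC ?_
    exact hC.elementaryAbelian_mem p hp hCp W (hW.isElementaryAbelian hcomm hp hdvd)
  · obtain ⟨ι, _, H, S, hne, hS, hperf, hHS, hHcomm, hind, htop⟩ := hW.exists_decomposition hcomm
    refine ⟨commutator E, inferInstance, commutator_inf_ker_eq_bot_of_pi π hπ hZ hp hker hperf
      (fun hdvd => hWC ?_) hHS hHcomm hind htop⟩
    exact C.mem_of_mulEquiv _ _ (nonempty_mulEquiv_pi hHS hHcomm hind htop)
      (hC.power_mem p hp hCp S inferInstance hS hdvd _ Fintype.card_pos)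

end CharacteristicallySimple
-- Splitting a central chief factor by climbing a chief series.
section ChiefSeries

open scoped commutatorElement

variable {G : Type u} [Group G]

theorem mem_map_comap_mk {X Y : Subgroup G} [Y.Normal] (T : Subgroup (X ⧸ Y.subgroupOf X)) (x : X) :
    x.1 ∈ (T.comap (QuotientGroup.mk' (Y.subgroupOf X))).map X.subtype ↔
      (x : X ⧸ Y.subgroupOf X) ∈ T := by
  constructor
  · rintro ⟨x', hx', h⟩
    rw [← Subtype.ext h]
    exact hx'
  · exact fun h => ⟨x, h, rfl⟩

/-- Conjugation by an element of `G` induces an automorphism of `X / Y`, which preserves `T`. -/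
theorem normal_map_comap_mk {X Y : Subgroup G} [hX : X.Normal] [hY : Y.Normal]
    {T : Subgroup (X ⧸ Y.subgroupOf X)} (hT : T.Characteristic) :
    ((T.comap (QuotientGroup.mk' (Y.subgroupOf X))).map X.subtype).Normal := by
  constructor
  rintro _ ⟨x, hx, rfl⟩ g
  let σ : X ≃* X := MulAut.conjNormal g
  have hσ : (Y.subgroupOf X).map (σ : X →* X) = Y.subgroupOf X := by
    ext y
    constructor
    · rintro ⟨y, hy, rfl⟩
      exact hY.conj_mem _ hy g
    · intro hy
      refine ⟨σ.symm y, ?_, σ.apply_symm_apply y⟩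
      change (((MulAut.conjNormal g)⁻¹ : MulAut X) y : G) ∈ Y
      rw [MulAut.conjNormal_inv_apply]
      have := hY.conj_mem _ hy g⁻¹
      rwa [inv_inv] at this
  have h := Subgroup.characteristic_iff_map_le.1 hT (QuotientGroup.congr _ _ σ hσ)
    (Subgroup.mem_map_of_mem _ hx)
  exact (mem_map_comap_mk T (σ x)).2 h

theorem isCharacteristicallySimple_of_chief {X Y : Subgroup G} [X.Normal] [Y.Normal] (hlt : Y < X)
    (hchief : ∀ M : Subgroup G, M.Normal → ¬ (Y < M ∧ M < X)) :
    IsCharacteristicallySimple (X ⧸ Y.subgroupOf X) := by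
  constructor
  · rw [QuotientGroup.nontrivial_iff]
    exact fun h => hlt.not_ge (Subgroup.subgroupOf_eq_top.1 h)
  · intro T hT
    set M := (T.comap (QuotientGroup.mk' (Y.subgroupOf X))).map X.subtype with hM
    have hMX : M ≤ X := Subgroup.map_subtype_le _
    have hYM : Y ≤ M := fun y hy => (mem_map_comap_mk T ⟨y, hlt.le hy⟩).2 (by
      rw [(QuotientGroup.eq_one_iff (⟨y, hlt.le hy⟩ : X)).2 hy]
      exact T.one_mem)
    have := hchief M (normal_map_comap_mk hT)
    by_cases h : Y = M
    · left
      rw [Subgroup.eq_bot_iff_forall]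
      intro x hx
      induction x using QuotientGroup.induction_on with
      | H x =>
        have := (mem_map_comap_mk T x).2 hx
        rw [← hM, ← h] at this
        exact (QuotientGroup.eq_one_iff x).2 this
    · right
      have hMX' : M = X := by
        by_contra hne
        exact this ⟨lt_of_le_of_ne hYM h, lt_of_le_of_ne hMX hne⟩
      rw [eq_top_iff]
      intro x _
      induction x using QuotientGroup.induction_on with
      | H x => exact (mem_map_comap_mk T x).1 (hM ▸ hMX'.symm ▸ x.2)

theorem commutatorElement_mul_mem {N : Subgroup G} [hN : N.Normal] {n a b : G} (hn : n ∈ N)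
    (h : ⁅a, b⁆ ∈ N) : ⁅n * a, b⁆ ∈ N := by
  have : ⁅n * a, b⁆ = n * ⁅a, b⁆ * (b * n⁻¹ * b⁻¹) := by
    simp only [commutatorElement_def]
    group
  rw [this]
  exact mul_mem (mul_mem hn h) (hN.conj_mem _ (inv_mem hn) b)

theorem commutator_sup_le {N A B : Subgroup G} [hN : N.Normal] (h : ⁅A, B⁆ ≤ N) :
    ⁅N ⊔ A, B⁆ ≤ N := by
  rw [Subgroup.commutator_le]
  intro x hx b hb
  obtain ⟨n, hn, a, ha, rfl⟩ := Subgroup.mem_sup_of_normal_left.1 hx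
  exact commutatorElement_mul_mem hn (h (Subgroup.commutator_mem_commutator ha hb))

variable {C : FiniteGroupClass.{u}} {p : ℕ}

/-- Lifting a complement through a chief factor which does not belong to the class. -/
theorem FiniteGroupClass.Star.exists_normal_of_chief (hC : C.Star) (hp : p.Prime)
    (hCp : ∃ (H : Type u) (_ : Group H), C.Mem H ∧ IsElementaryAbelian p H)
    {X X' Y' : Subgroup G} [X.Normal] [X'.Normal] [Y'.Normal] [Y'.FiniteIndex]
    (hYX' : Y' ≤ X') (hlt : X' < X) (hchief : ∀ M : Subgroup G, M.Normal → ¬ (X' < M ∧ M < X))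
    (hcent : ⁅X', X⁆ ≤ Y') (hexp : ∀ x ∈ X', x ^ p ∈ Y') (hXC : ¬ C.Mem (X ⧸ X'.subgroupOf X)) :
    ∃ Y : Subgroup G, Y.Normal ∧ Y ⊓ X' = Y' ∧ Y ⊔ X' = X := by
  have hle : Y'.subgroupOf X ≤ (X'.subgroupOf X).comap (MonoidHom.id X) := fun x hx => hYX' hx
  let π : X ⧸ Y'.subgroupOf X →* X ⧸ X'.subgroupOf X := QuotientGroup.map _ _ (MonoidHom.id X) hle
  have hπ : Function.Surjective π := by
    intro w
    induction w using QuotientGroup.induction_on with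
    | H x => exact ⟨x, rfl⟩
  have hk (x : X) : (x : X ⧸ Y'.subgroupOf X) ∈ π.ker ↔ x.1 ∈ X' :=
    QuotientGroup.eq_one_iff (N := X'.subgroupOf X) x
  obtain ⟨T, hT, hTk, hTs⟩ := hC.exists_characteristic_complement hp hCp π hπ
    (by
      intro z hz
      rw [Subgroup.mem_center_iff]
      intro g
      induction z using QuotientGroup.induction_on with
      | H z =>
        induction g using QuotientGroup.induction_on with
        | H g =>
          rw [eq_comm, ← commutatorElement_eq_one_iff_mul_comm]
          exact (QuotientGroup.eq_one_iff (N := Y'.subgroupOf X) ⁅z, g⁆).2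
            (hcent (Subgroup.commutator_mem_commutator ((hk z).1 hz) g.2)))
    (by
      intro z hz
      induction z using QuotientGroup.induction_on with
      | H z =>
        exact (QuotientGroup.mk_pow (Y'.subgroupOf X) z p).symm.trans
          ((QuotientGroup.eq_one_iff (N := Y'.subgroupOf X) (z ^ p)).2 (hexp z ((hk z).1 hz))))
    (isCharacteristicallySimple_of_chief hlt hchief) hXC
  refine ⟨_, normal_map_comap_mk hT, le_antisymm ?_ (le_inf ?_ hYX'), le_antisymm ?_ ?_⟩
  · rintro _ ⟨⟨x, hx, rfl⟩, hx'⟩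
    have : (x : X ⧸ Y'.subgroupOf X) ∈ T ⊓ π.ker := ⟨hx, (hk x).2 hx'⟩
    rw [hTk, Subgroup.mem_bot] at this
    exact (QuotientGroup.eq_one_iff (N := Y'.subgroupOf X) x).1 this
  · intro y hy
    refine (mem_map_comap_mk T ⟨y, hlt.le (hYX' hy)⟩).2 ?_
    rw [(QuotientGroup.eq_one_iff (N := Y'.subgroupOf X) ⟨y, hlt.le (hYX' hy)⟩).2 hy]
    exact T.one_mem
  · exact sup_le (Subgroup.map_subtype_le _) hlt.le
  · intro x hx
    have hxT : ((⟨x, hx⟩ : X) : X ⧸ Y'.subgroupOf X) ∈ T ⊔ π.ker := hTs ▸ Subgroup.mem_top _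
    obtain ⟨t, ht, z, hz, htz⟩ := Subgroup.mem_sup_of_normal_right.1 hxT
    induction t using QuotientGroup.induction_on with
    | H t =>
      have hz' : ((t⁻¹ * ⟨x, hx⟩ : X) : X ⧸ Y'.subgroupOf X) ∈ π.ker := by
        rw [QuotientGroup.mk_mul, ← htz, QuotientGroup.mk_inv, inv_mul_cancel_left]
        exact hz
      have : x = t.1 * (t⁻¹ * ⟨x, hx⟩ : X).1 := by simp
      rw [this]
      exact Subgroup.mul_mem_sup ((mem_map_comap_mk T t).2 ht) ((hk _).1 hz')

/-- A central chief factor `K / L` of exponent `p` splits off if no chief factor above it belongs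
to the class. -/
theorem FiniteGroupClass.Star.exists_normal_complement (hC : C.Star) (hp : p.Prime)
    (hCp : ∃ (H : Type u) (_ : Group H), C.Mem H ∧ IsElementaryAbelian p H)
    {K L R : Subgroup G} (hKn : K.Normal) (hLn : L.Normal) (hRn : R.Normal) [L.FiniteIndex]
    (hLK : L ≤ K) (hKR : K ≤ R) (hcent : ⁅K, R⁆ ≤ L) (hexp : ∀ x ∈ K, x ^ p ∈ L)
    (hno : ∀ X X' : Subgroup G, ∀ (_ : X.Normal) (_ : X'.Normal), K ≤ X' → X' < X → X ≤ R →
      (∀ M : Subgroup G, M.Normal → ¬ (X' < M ∧ M < X)) → ¬ C.Mem (X ⧸ X'.subgroupOf X)) :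
    ∃ Y : Subgroup G, Y.Normal ∧ Y ⊓ K = L ∧ Y ⊔ K = R := by
  have hfin := finite_setOf_ge L
  suffices h : ∀ X : Subgroup G, X.Normal → K ≤ X → X ≤ R →
      ∃ Y : Subgroup G, Y.Normal ∧ Y ⊓ K = L ∧ Y ⊔ K = X from h R hRn hKR le_rfl
  by_contra! hcon
  obtain ⟨X₀, hX₀, hKX₀, hX₀R, hX₀'⟩ := hcon
  -- A minimal `X` over which `K / L` does not split. A complement `Y'` exists for the next term
  -- `X'` of a chief series, and it lifts through `X / X'` because `X' / Y'` is central in `X / Y'`.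
  obtain ⟨X, hX⟩ := (hfin.subset (t := {X | (X.Normal ∧ K ≤ X ∧ X ≤ R) ∧
    ∀ Y : Subgroup G, Y.Normal → Y ⊓ K = L → Y ⊔ K ≠ X}) fun X h => hLK.trans h.1.2.1).exists_minimal
    ⟨X₀, ⟨hX₀, hKX₀, hX₀R⟩, hX₀'⟩
  obtain ⟨⟨hXn, hKX, hXR⟩, hXY⟩ := hX.1
  have hlt : K < X := by
    refine lt_of_le_of_ne hKX ?_
    rintro rfl
    exact hXY L hLn (inf_eq_left.2 hLK) (sup_eq_right.2 hLK)
  obtain ⟨X', hX'⟩ := (hfin.subset (t := {M | M.Normal ∧ K ≤ M ∧ M < X})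
    fun M h => hLK.trans h.2.1).exists_maximal ⟨K, hKn, le_rfl, hlt⟩
  obtain ⟨hX'n, hKX', hX'X⟩ := hX'.1
  obtain ⟨Y', hY'n, hY'K, hY'X'⟩ : ∃ Y : Subgroup G, Y.Normal ∧ Y ⊓ K = L ∧ Y ⊔ K = X' := by
    by_contra! h
    exact hX'X.not_ge (hX.2 ⟨⟨hX'n, hKX', hX'X.le.trans hXR⟩, h⟩ hX'X.le)
  have hchief : ∀ M : Subgroup G, M.Normal → ¬ (X' < M ∧ M < X) := fun M hM h =>
    h.1.not_ge (hX'.2 ⟨hM, hKX'.trans h.1.le, h.2⟩ h.1.le)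
  have hLY' : L ≤ Y' := hY'K ▸ inf_le_left
  have : Y'.FiniteIndex := Subgroup.finiteIndex_of_le hLY'
  obtain ⟨Y, hYn, hYX', hYX⟩ := hC.exists_normal_of_chief hp hCp (hY'X' ▸ le_sup_left) hX'X hchief
    (by
      rw [← hY'X']
      exact commutator_sup_le (((Subgroup.commutator_mono le_rfl hXR).trans hcent).trans hLY'))
    (by
      intro x hx
      rw [← hY'X'] at hx
      obtain ⟨y, hy, k, hk, rfl⟩ := Subgroup.mem_sup_of_normal_left.1 hx
      rw [← QuotientGroup.eq_one_iff, QuotientGroup.mk_pow, QuotientGroup.mk_mul,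
        (QuotientGroup.eq_one_iff y).2 hy, one_mul, ← QuotientGroup.mk_pow,
        QuotientGroup.eq_one_iff]
      exact hLY' (hexp k hk))
    (hno X X' hXn hX'n hKX' hX'X hXR hchief)
  have hY'Y : Y' ≤ Y := hYX' ▸ inf_le_left
  refine hXY Y hYn ?_ ?_
  · rw [← hY'K, ← hYX', inf_assoc, inf_eq_right.2 hKX']
  · rw [← hYX, ← hY'X', ← sup_assoc, sup_eq_left.2 hY'Y]

end ChiefSeries

/-! ### Chief factors with small centralizer. -/

section Centralizers

set_option linter.unusedSectionVars false

open scoped commutatorElement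

variable {G : Type u} [Group G] [TopologicalSpace G] [IsTopologicalGroup G] [CompactSpace G]

theorem IsJustInfinite.isOpen_chiefFactor_K (hG : IsJustInfinite G) (F : ChiefFactor G) :
    IsOpen (F.K : Set G) :=
  hG.isOpen ⟨F.normal_K, F.closed_K⟩ (ne_bot_of_gt F.lt)

theorem IsJustInfinite.isOpen_chiefFactor_L (hG : IsJustInfinite G) (F : ChiefFactor G)
    (hF : Finite F.Quot) : IsOpen (F.L : Set G) := by
  have hK := finiteIndex_of_isOpen (hG.isOpen_chiefFactor_K F)
  have : F.L.FiniteIndex := ⟨by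
    rw [← Subgroup.relIndex_mul_index F.lt.le]
    exact mul_ne_zero (Nat.card_pos (α := F.Quot)).ne' hK.index_ne_zero⟩
  exact F.L.isOpen_of_isClosed_of_finiteIndex F.closed_L

/-- Otherwise every open normal subgroup of `H`, being open in `G`, contains a lower central term,
and `H` is pronilpotent. -/
theorem exists_isOpen_not_lowerCentralSeries_le (hvp : ¬ IsVirtuallyPronilpotent G)
    {H : Subgroup G} (hH : IsOpen (H : Set G)) :
    ∃ U : Subgroup G, IsOpen (U : Set G) ∧ ∀ k, ¬ H.lowerCentralSeries k ≤ U := by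
  by_contra! hcon
  refine hvp ⟨⟨H, hH⟩, fun N => ?_⟩
  have hM : IsOpen ((N.toSubgroup.map H.subtype : Subgroup G) : Set G) :=
    hH.isOpenMap_subtype_val _ N.isOpen'
  obtain ⟨k, hk⟩ := hcon _ hM
  rw [Subgroup.nilpotent_iff_lowerCentralSeries]
  refine ⟨k, ?_⟩
  rw [← Subgroup.map_top_of_surjective _ (QuotientGroup.mk'_surjective N.toSubgroup),
    ← Subgroup.map_lowerCentralSeries, Subgroup.map_eq_bot_iff, QuotientGroup.ker_mk']
  intro x hx
  have hx' : x.1 ∈ H.lowerCentralSeries k := by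
    rw [← Subgroup.top_subtype_lowerCentralSeries]
    exact ⟨x, hx, rfl⟩
  obtain ⟨y, hy, hyx⟩ := hk hx'
  rw [← show y = x from Subtype.ext hyx]
  exact hy

theorem IsJustInfinite.exists_chiefFactor_centralizer_le (hG : IsJustInfinite G)
    (hvp : ¬ IsVirtuallyPronilpotent G) {C : FiniteGroupClass.{u}}
    (hinf : {F : ChiefFactor G | C.Mem F.Quot}.Infinite) (hC : C.Star) {H B : Subgroup G}
    (hHn : H.Normal) (hH : IsOpen (H : Set G)) (hB : IsOpen (B : Set G)) :
    ∃ F : ChiefFactor G, C.Mem F.Quot ∧ F.K ≤ H ∧ ∀ g, (∀ k ∈ F.K, ⁅k, g⁆ ∈ F.L) → g ∈ B := by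
  by_contra! hcon
  obtain ⟨I, hIn, hIo, hI⟩ := hG.exists_open_le_or_le hB
  have hLo : ∀ F : ChiefFactor G, C.Mem F.Quot → IsOpen (F.L : Set G) := fun F hF =>
    hG.isOpen_chiefFactor_L F (C.finite_of_mem _ hF)
  -- The centralizer `Z` of `K / L` is an open normal subgroup not inside `B`, so it contains `I`.
  have hcomm : ∀ F : ChiefFactor G, C.Mem F.Quot → F.K ≤ H → ⁅F.K, I⁆ ≤ F.L := by
    intro F hF hFH
    have := F.normal_L
    have := F.normal_K
    let Z : Subgroup G := (Subgroup.centralizer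
      (F.K.map (QuotientGroup.mk' F.L) : Set (G ⧸ F.L))).comap (QuotientGroup.mk' F.L)
    have hZ : ∀ g, g ∈ Z ↔ ∀ k ∈ F.K, ⁅k, g⁆ ∈ F.L := by
      intro g
      rw [Subgroup.mem_comap, Subgroup.mem_centralizer_iff]
      have key : ∀ k, (QuotientGroup.mk' F.L k * QuotientGroup.mk' F.L g =
          QuotientGroup.mk' F.L g * QuotientGroup.mk' F.L k ↔ ⁅k, g⁆ ∈ F.L) := fun k => by
        rw [← commutatorElement_eq_one_iff_mul_comm, ← map_commutatorElement]
        exact QuotientGroup.eq_one_iff _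
      constructor
      · exact fun h k hk => (key k).1 (h _ (Subgroup.mem_map_of_mem _ hk))
      · rintro h _ ⟨k, hk, rfl⟩
        exact (key k).2 (h k hk)
    have hKn : (F.K.map (QuotientGroup.mk' F.L)).Normal :=
      F.normal_K.map _ (QuotientGroup.mk'_surjective _)
    have hZn : Z.Normal := Subgroup.normal_centralizer.comap _
    have hLZ : F.L ≤ Z := fun l hl => (hZ l).2 fun k _ =>
      mul_mem (F.normal_L.conj_mem l hl k) (inv_mem hl)
    rcases hI Z (isClosedNormal_of_isOpen hZn (Subgroup.isOpen_mono hLZ (hLo F hF))) with h | h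
    · obtain ⟨g, hg, hgB⟩ := hcon F hF hFH
      exact absurd (h ((hZ g).2 hg)) hgB
    · exact Subgroup.commutator_le.2 fun k hk g hg => (hZ g).1 (h hg) k hk
  have hJn : (H ⊓ I).Normal := inferInstance
  have hJo : IsOpen ((H ⊓ I : Subgroup G) : Set G) := hH.inter hIo
  obtain ⟨U, hU, hUγ⟩ := exists_isOpen_not_lowerCentralSeries_le hvp hJo
  obtain ⟨R, -, hR⟩ := hG.exists_minimal hU (P := fun N => IsClosedNormal N ∧ N ≤ H ⊓ I ∧
    ∃ k, (H ⊓ I).lowerCentralSeries k ≤ N) (fun N ⟨h, _, k, hk⟩ => ⟨h, fun hle => hUγ k (hk.trans hle)⟩)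
    (N₀ := H ⊓ I) ⟨isClosedNormal_of_isOpen hJn hJo, le_rfl, 0, le_rfl⟩
  obtain ⟨hRc, hRJ, k, hk⟩ := hR.1
  have hRn := hRc.1
  have hRo : IsOpen (R : Set G) :=
    hG.isOpen_of_not_le hRc fun hle => hUγ k (hk.trans hle)
  obtain ⟨F₀, hF₀, hF₀R⟩ := hG.exists_chiefFactor_le hRn hRo hinf
  -- Least index of `K` ensures that no chief factor between `K` and `R` is in the class.
  obtain ⟨F, ⟨hF, hFR⟩, hmin⟩ := (measure fun F : ChiefFactor G => F.K.index).wf.has_min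
    {F | C.Mem F.Quot ∧ F.K ≤ R} ⟨F₀, hF₀, hF₀R⟩
  have hFn := F.normal_K
  have hFn' := F.normal_L
  have hFo := hLo F hF
  have hFJ : ⁅F.K, H ⊓ I⁆ ≤ F.L := (Subgroup.commutator_mono le_rfl inf_le_right).trans
    (hcomm F hF (hFR.trans (hRJ.trans inf_le_left)))
  have := finiteIndex_of_isOpen hFo
  have := C.finite_of_mem _ hF
  have hcs := hC.charSimple _ hF
  have hab : ∀ x y : F.Quot, x * y = y * x := by
    intro x y
    induction x using QuotientGroup.induction_on with
    | H x =>
      induction y using QuotientGroup.induction_on with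
      | H y =>
        rw [← commutatorElement_eq_one_iff_mul_comm]
        exact (QuotientGroup.eq_one_iff (N := F.L.subgroupOf F.K) ⁅x, y⁆).2
          (hFJ (Subgroup.commutator_mem_commutator x.2 (hRJ (hFR y.2))))
  have hcard : Nat.card F.Quot ≠ 1 := by
    have := hcs.1
    exact Finite.one_lt_card.ne'
  have hp := Nat.minFac_prime hcard
  have hel := hcs.isElementaryAbelian hab hp (Nat.minFac_dvd _)
  obtain ⟨Y, hYn, hYK, hYR⟩ := hC.exists_normal_complement hp ⟨_, _, hF, hel⟩ hFn hFn' hRn F.lt.le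
    hFR ((Subgroup.commutator_mono le_rfl hRJ).trans hFJ)
    (fun x hx => (QuotientGroup.eq_one_iff (N := F.L.subgroupOf F.K) (⟨x, hx⟩ ^ _ : F.K)).1
      ((QuotientGroup.mk_pow (F.L.subgroupOf F.K) ⟨x, hx⟩ _).trans
        (hel.2.2.2 ((⟨x, hx⟩ : F.K) : F.Quot))))
    (fun X X' hX hX' hKX' hlt hXR hchief hmem => by
      have hX'o := Subgroup.isOpen_mono (F.lt.le.trans hKX') hFo
      let F' : ChiefFactor G :=
        { K := X
          L := X'
          normal_K := hX
          normal_L := hX'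
          closed_K := X.isClosed_of_isOpen (Subgroup.isOpen_mono hlt.le hX'o)
          closed_L := X'.isClosed_of_isOpen hX'o
          lt := hlt
          chief := fun M hM _ => hchief M hM }
      have : F.K.FiniteIndex := Subgroup.finiteIndex_of_le F.lt.le
      exact hmin F' ⟨hmem, hXR⟩ (Subgroup.index_strictAnti (lt_of_le_of_lt hKX' hlt)))
  have hLY : F.L ≤ Y := hYK ▸ inf_le_left
  have hYR' : Y ≤ R := hYR ▸ le_sup_left
  -- Since `R = YK` and `⁅K, J⁆ ≤ L ≤ Y` for `J = H ⊓ I`, the next lower central term of `J` falls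
  -- into `Y`.
  have hRY : R ≤ Y := hR.2 ⟨isClosedNormal_of_isOpen hYn (Subgroup.isOpen_mono hLY hFo),
    hYR'.trans hRJ, k + 1, by
      rw [Subgroup.lowerCentralSeries_succ]
      refine (Subgroup.commutator_mono hk le_rfl).trans ?_
      rw [← hYR]
      exact commutator_sup_le (hFJ.trans hLY)⟩ hYR'
  exact F.lt.not_ge (hYK ▸ le_inf (hFR.trans hRY) le_rfl)

end Centralizers
-- A profinite group as the limit of its quotients by a descending sequence.
section QuotientSystem

variable {G : Type u} [Group G]

/-- The inverse system of the quotients by a descending sequence of normal subgroups of finite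
index. -/
def quotientSystem (N : ℕ → Subgroup G) (hn : ∀ n, (N n).Normal) (hfin : ∀ n, Finite (G ⧸ N n))
    (hle : ∀ n, N (n + 1) ≤ N n) : FiniteInverseSystem.{u} where
  obj n := G ⧸ N n
  group n := QuotientGroup.Quotient.group (N n)
  finite := hfin
  map n := QuotientGroup.map (N (n + 1)) (N n) (MonoidHom.id G) (hle n)
  surjective n x := by
    induction x using QuotientGroup.induction_on with
    | H g => exact ⟨(g : G ⧸ N (n + 1)), rfl⟩

namespace quotientSystem

variable (N : ℕ → Subgroup G) (hn : ∀ n, (N n).Normal) (hfin : ∀ n, Finite (G ⧸ N n))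
  (hle : ∀ n, N (n + 1) ≤ N n)

/-- The projection to the `n`th term of the system. -/
def proj (n : ℕ) : G →* (quotientSystem N hn hfin hle).obj n :=
  QuotientGroup.mk' (N n)

theorem proj_surjective (n : ℕ) : Function.Surjective (proj N hn hfin hle n) :=
  QuotientGroup.mk'_surjective (N n)

theorem ker_proj (n : ℕ) : (proj N hn hfin hle n).ker = N n :=
  QuotientGroup.ker_mk' (N n)

theorem map_proj (n : ℕ) (g : G) :
    (quotientSystem N hn hfin hle).map n (proj N hn hfin hle (n + 1) g) = proj N hn hfin hle n g :=
  rfl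

variable [TopologicalSpace G] [IsTopologicalGroup G]

theorem continuous_proj (ho : ∀ n, IsOpen (N n : Set G)) (n : ℕ) :
    Continuous (proj N hn hfin hle n) := by
  have : DiscreteTopology (G ⧸ N n) := QuotientGroup.discreteTopology (ho n)
  let i : G ⧸ N n → (quotientSystem N hn hfin hle).obj n := id
  have hi : Continuous i := continuous_of_discreteTopology
  exact hi.comp QuotientGroup.continuous_mk

theorem nonempty_continuousMulEquiv_limit [CompactSpace G] (ho : ∀ n, IsOpen (N n : Set G))
    (hbot : ∀ g, (∀ n, g ∈ N n) → g = 1) :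
    Nonempty (G ≃ₜ* (quotientSystem N hn hfin hle).limit) := by
  let Λ := quotientSystem N hn hfin hle
  have hc := continuous_proj N hn hfin hle ho
  let f : G →* Λ.limit := (MonoidHom.pi (proj N hn hfin hle)).codRestrict _ fun g n => rfl
  have hf : Continuous f := Continuous.subtype_mk (continuous_pi hc) _
  have hinj : Function.Injective f := by
    rw [injective_iff_map_eq_one]
    intro g hg
    refine hbot g fun n => ?_
    rw [← ker_proj N hn hfin hle n]
    exact congrFun (congrArg Subtype.val hg) n
  have hsurj : Function.Surjective f := by
    rintro ⟨x, hx⟩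
    have hcl (n : ℕ) : IsClosed {g | proj N hn hfin hle n g = x n} :=
      (isClosed_discrete {x n}).preimage (hc n)
    obtain ⟨g, hg⟩ := IsCompact.nonempty_iInter_of_directed_nonempty_isCompact_isClosed
      (fun n => {g | proj N hn hfin hle n g = x n})
      (Antitone.directed_ge (antitone_nat_of_succ_le fun n g hg => by
        change proj N hn hfin hle n g = x n
        rw [← hx n, ← map_proj]
        exact congrArg _ hg))
      (fun n => proj_surjective N hn hfin hle n (x n)) (fun n => (hcl n).isCompact) hcl
    rw [Set.mem_iInter] at hg
    exact ⟨g, Subtype.ext (funext hg)⟩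
  let e := MulEquiv.ofBijective f ⟨hinj, hsurj⟩
  exact ⟨{ e with
    continuous_toFun := hf
    continuous_invFun := Continuous.continuous_symm_of_equiv_compact_to_t2 (f := e.toEquiv) hf }⟩

end quotientSystem

end QuotientSystem

/-! ### The descending sequence of narrow subgroups. -/

section Construction

set_option linter.unusedSectionVars false

open scoped commutatorElement

variable {G : Type u} [Group G] [TopologicalSpace G]

/-- Pairs of open normal subgroups `lower < upper`. -/
structure OpenNormalPair (G : Type u) [Group G] [TopologicalSpace G] where
  upper : Subgroup G
  lower : Subgroup G
  normal_upper : upper.Normal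
  normal_lower : lower.Normal
  isOpen_lower : IsOpen (lower : Set G)
  lt : lower < upper

instance (t : OpenNormalPair G) : t.upper.Normal := t.normal_upper

instance (t : OpenNormalPair G) : t.lower.Normal := t.normal_lower

/-- The relation between consecutive terms of the sequence of narrow subgroups. -/
structure OpenNormalPair.Refines (C : FiniteGroupClass.{u}) (t s : OpenNormalPair G) : Prop where
  le : t.upper ≤ s.lower
  narrow : ∀ M, IsClosedNormal M → M < t.upper → M ≤ t.lower
  oblique : ∀ N, IsClosedNormal N → t.upper ≤ N ∨ N ≤ s.upper
  mem : C.Mem (t.upper ⧸ t.lower.subgroupOf t.upper)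
  centralizer_le : ∀ g, (∀ a ∈ t.upper, ⁅a, g⁆ ∈ t.lower) → g ∈ s.lower

variable [IsTopologicalGroup G] [CompactSpace G]

theorem OpenNormalPair.isOpen_upper (t : OpenNormalPair G) : IsOpen (t.upper : Set G) :=
  Subgroup.isOpen_mono t.lt.le t.isOpen_lower

theorem IsJustInfinite.exists_refines (hG : IsJustInfinite G) (hvp : ¬ IsVirtuallyPronilpotent G)
    {C : FiniteGroupClass.{u}} (hinf : {F : ChiefFactor G | C.Mem F.Quot}.Infinite) (hC : C.Star)
    (s : OpenNormalPair G) : ∃ t : OpenNormalPair G, t.Refines C s := by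
  obtain ⟨I, hIn, hIo, hI⟩ := hG.exists_open_le_or_le s.isOpen_upper
  obtain ⟨F, hF, hFK, hFc⟩ := hG.exists_chiefFactor_centralizer_le hvp hinf hC
    (H := I ⊓ s.lower) (B := s.lower) inferInstance (hIo.inter s.isOpen_lower) s.isOpen_lower
  have hLo := hG.isOpen_chiefFactor_L F (C.finite_of_mem _ hF)
  have hKn := F.normal_K
  have hLn := F.normal_L
  -- Minimality makes `A ⊓ L` the largest closed normal subgroup properly inside `A`. As `LA = K`,
  -- the quotient `A / (A ⊓ L)` is isomorphic to `K / L`, and whatever centralizes it centralizes `K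
  -- / L`.
  obtain ⟨A, -, hA⟩ := hG.exists_minimal hLo
    (P := fun N => IsClosedNormal N ∧ N ≤ F.K ∧ ¬ N ≤ F.L) (fun N h => ⟨h.1, h.2.2⟩)
    (N₀ := F.K) ⟨⟨hKn, F.closed_K⟩, le_rfl, F.lt.not_ge⟩
  obtain ⟨hAc, hAK, hAL⟩ := hA.1
  have hAn := hAc.1
  have hsup : F.L ⊔ A = F.K := by
    by_contra hne
    refine F.chief (F.L ⊔ A) inferInstance
      ((F.L ⊔ A).isClosed_of_isOpen (Subgroup.isOpen_mono le_sup_left hLo))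
      ⟨left_lt_sup.2 hAL, lt_of_le_of_ne (sup_le F.lt.le hAK) hne⟩
  let t : OpenNormalPair G :=
    { upper := A
      lower := A ⊓ F.L
      normal_upper := hAn
      normal_lower := inferInstance
      isOpen_lower := (hG.isOpen_of_not_le hAc hAL).inter hLo
      lt := inf_lt_left.2 hAL }
  refine ⟨t, hAK.trans (hFK.trans inf_le_right), fun M hM hMA => ?_, fun N hN => ?_, ?_,
    fun g hg => hFc g fun k hk => ?_⟩
  · refine le_inf hMA.le ?_
    by_contra hML
    exact hMA.not_ge (hA.2 ⟨hM, hMA.le.trans hAK, hML⟩ hMA.le)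
  · exact (hI N hN).symm.imp_left fun h => (hAK.trans (hFK.trans inf_le_left)).trans h
  · let f : t.upper →* F.Quot := (QuotientGroup.mk' (F.L.subgroupOf F.K)).comp
      (Subgroup.inclusion hAK)
    have hf : Function.Surjective f := by
      intro x
      induction x using QuotientGroup.induction_on with
      | H x =>
        have hx : x.1 ∈ F.L ⊔ A := hsup.ge x.2
        obtain ⟨a, ha, l, hl, hal⟩ := Subgroup.mem_sup_of_normal_right.1
          (by rwa [sup_comm] at hx : x.1 ∈ A ⊔ F.L)
        refine ⟨⟨a, ha⟩, QuotientGroup.eq.2 ?_⟩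
        change a⁻¹ * x.1 ∈ F.L
        rw [← hal, inv_mul_cancel_left]
        exact hl
    have hker : f.ker = t.lower.subgroupOf t.upper := by
      ext a
      refine (QuotientGroup.eq_one_iff (N := F.L.subgroupOf F.K) (Subgroup.inclusion hAK a)).trans ?_
      exact ⟨fun h => ⟨a.2, h⟩, fun h => h.2⟩
    exact C.mem_of_mulEquiv _ _ ⟨((QuotientGroup.quotientMulEquivOfEq hker).symm.trans
      (QuotientGroup.quotientKerEquivOfSurjective f hf)).symm⟩ hF
  · rw [← hsup] at hk
    obtain ⟨l, hl, a, ha, rfl⟩ := Subgroup.mem_sup_of_normal_left.1 hk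
    exact commutatorElement_mul_mem hl (hg a ha).2

theorem IsJustInfinite.exists_openNormalPair [TotallyDisconnectedSpace G]
    (hG : IsJustInfinite G) : Nonempty (OpenNormalPair G) := by
  have := hG.infinite
  obtain ⟨x, hx⟩ := exists_ne (1 : G)
  obtain ⟨U, hU⟩ := ProfiniteGrp.exist_openNormalSubgroup_sub_open_nhds_of_one
    (isOpen_compl_singleton (x := x)) (Set.mem_compl_singleton_iff.2 hx.symm)
  refine ⟨⟨⊤, U.toSubgroup, inferInstance, inferInstance, U.isOpen', lt_top_iff_ne_top.2 ?_⟩⟩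
  intro h
  have : x ∈ U.toSubgroup := h ▸ Subgroup.mem_top x
  exact hU this rfl

theorem IsJustInfinite.exists_seq_refines [TotallyDisconnectedSpace G] (hG : IsJustInfinite G)
    (hvp : ¬ IsVirtuallyPronilpotent G) {C : ℕ → FiniteGroupClass.{u}}
    (hinf : ∀ n, {F : ChiefFactor G | (C n).Mem F.Quot}.Infinite) (hC : ∀ n, (C n).Star) :
    ∃ s : ℕ → OpenNormalPair G, ∀ n, (s (n + 1)).Refines (C n) (s n) := by
  choose step hstep using fun n => hG.exists_refines hvp (hinf n) (hC n)
  exact ⟨fun n => Nat.rec hG.exists_openNormalPair.some (fun n s => step n s) n,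
    fun n => hstep n _⟩

end Construction

/-! ### Transfer of the properties to quotients. -/

section Correspondence

variable {G : Type*} [Group G] {Γ : Type*} [Group Γ] {q : G →* Γ}

theorem map_le_map_iff_of_ker_le {S T : Subgroup G} (hT : q.ker ≤ T) :
    S.map q ≤ T.map q ↔ S ≤ T := by
  rw [Subgroup.map_le_iff_le_comap, Subgroup.comap_map_eq_self hT]

theorem map_eq_bot_iff_le {S T : Subgroup G} (h : q.ker = T) : S.map q = ⊥ ↔ S ≤ T := by
  rw [Subgroup.map_eq_bot_iff, h]

/-- If `B` is the largest normal subgroup above the kernel and properly below `A`, then the image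
of `B` lies in all maximal invariant subgroups of the image of `A`. -/
theorem map_le_relMelnikov (hq : Function.Surjective q) {A B : Subgroup G} (hB : B.Normal)
    (hBA : B < A) (hker : q.ker ≤ B)
    (hnar : ∀ M : Subgroup G, M.Normal → q.ker ≤ M → M < A → M ≤ B) :
    B.map q ≤ relMelnikov (A.map q) := by
  refine le_inf (Subgroup.map_mono hBA.le) (le_sInf fun M hM => ?_)
  have hMn := hM.1.1
  have hlt : M.comap q < A := by
    refine lt_of_le_not_ge ?_ fun h => hM.1.2.not_ge (Subgroup.map_le_iff_le_comap.2 h)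
    rw [← Subgroup.comap_map_eq_self (hker.trans hBA.le)]
    exact Subgroup.comap_mono hM.1.2.le
  have hMB := hnar (M.comap q) inferInstance (Subgroup.ker_le_comap q M) hlt
  refine hM.2 ⟨hB.map q hq, lt_of_le_not_ge (Subgroup.map_mono hBA.le) fun h => ?_⟩ ?_
  · exact hBA.not_ge ((map_le_map_iff_of_ker_le hker).1 h)
  · rw [← Subgroup.map_comap_eq_self_of_surjective hq M]
    exact Subgroup.map_mono hMB

theorem isMinimalNormal_map (hq : Function.Surjective q) {A B : Subgroup G} (hA : A.Normal)
    (hBA : B < A) (hker : q.ker = B)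
    (hnar : ∀ M : Subgroup G, M.Normal → q.ker ≤ M → M < A → M ≤ B) :
    IsMinimalNormal (A.map q) := by
  refine ⟨⟨hA.map q hq, fun h => hBA.not_ge ((map_eq_bot_iff_le hker).1 h)⟩, fun N hN hNA => ?_⟩
  have hNn := hN.1
  have hle : N.comap q ≤ A := by
    rw [← Subgroup.comap_map_eq_self (hker.le.trans hBA.le)]
    exact Subgroup.comap_mono hNA
  rcases eq_or_lt_of_le hle with h | h
  · exact Subgroup.map_le_iff_le_comap.2 h.ge
  · have := hnar (N.comap q) inferInstance (Subgroup.ker_le_comap q N) h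
    refine absurd ?_ hN.2
    rw [← Subgroup.map_comap_eq_self_of_surjective hq N]
    exact (map_eq_bot_iff_le hker).2 this

theorem nonempty_quotient_mulEquiv_map (A : Subgroup G) {B : Subgroup G} [B.Normal]
    (hker : q.ker = B) : Nonempty ((A ⧸ B.subgroupOf A) ≃* A.map q) := by
  have hk : (q.subgroupMap A).ker = B.subgroupOf A := by
    ext a
    rw [Subgroup.mem_subgroupOf, ← hker, MonoidHom.mem_ker, MonoidHom.mem_ker, Subtype.ext_iff]
    rfl
  exact ⟨(QuotientGroup.quotientMulEquivOfEq hk).symm.trans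
    (QuotientGroup.quotientKerEquivOfSurjective _ (q.subgroupMap_surjective A))⟩

open scoped commutatorElement in
theorem centralizer_map_le (hq : Function.Surjective q) {A B D : Subgroup G} (hker : q.ker = B)
    (h : ∀ g, (∀ a ∈ A, ⁅a, g⁆ ∈ B) → g ∈ D) :
    Subgroup.centralizer (A.map q : Set Γ) ≤ D.map q := by
  intro x hx
  obtain ⟨g, rfl⟩ := hq x
  refine Subgroup.mem_map_of_mem q (h g fun a ha => ?_)
  rw [← hker, MonoidHom.mem_ker, map_commutatorElement, commutatorElement_eq_one_iff_mul_comm]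
  exact Subgroup.mem_centralizer_iff.1 hx _ (Subgroup.mem_map_of_mem q ha)

end Correspondence

end JustInf

/-! ### Assembly of the inverse system. -/

open JustInf
theorem corollary4p5 (G : Type u) [Group G] [TopologicalSpace G] [IsTopologicalGroup G]
    [CompactSpace G] [TotallyDisconnectedSpace G]
    (hG : IsJustInfinite G) (hvp : ¬ IsVirtuallyPronilpotent G)
    (C : ℕ → FiniteGroupClass.{u})
    (hinf : ∀ n, {F : ChiefFactor G | (C n).Mem F.Quot}.Infinite)
    (hstar : ∀ n, (C n).Star) :
    ∃ (Λ : FiniteInverseSystem.{u}) (A : ∀ n, Subgroup (Λ.obj n)),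
      Nonempty (G ≃ₜ* Λ.limit) ∧
      (∀ n, (A n).Normal ∧ A n ≠ ⊥) ∧
      (∀ n, (Λ.map n).ker ≤ relMelnikov (A (n + 1)) ∧ Λ.P A (n + 1) ≤ (Λ.map n).ker) ∧
      (∀ n, ∀ N : Subgroup (Λ.obj n), N.Normal → Λ.P A n ≤ N ∨ N ≤ A n) ∧
      (∀ n, IsMinimalNormal (Λ.P A n)) ∧
      (∀ n, (C n).Mem (Λ.P A n)) ∧
      (∀ n, Subgroup.centralizer (Λ.P A n : Set (Λ.obj n)) < A n) := by
  obtain ⟨s, hs⟩ := hG.exists_seq_refines hvp hinf hstar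
  have hlu (n : ℕ) : (s (n + 1)).lower < (s n).lower := (s (n + 1)).lt.trans_le (hs n).le
  have ho (n : ℕ) := (s (n + 1)).isOpen_lower
  have hn (n : ℕ) : (s (n + 1)).lower.Normal := inferInstance
  have hfin (n : ℕ) : Finite (G ⧸ (s (n + 1)).lower) := Subgroup.quotient_finite_of_isOpen _ (ho n)
  have hle (n : ℕ) : (s (n + 1 + 1)).lower ≤ (s (n + 1)).lower := (hlu (n + 1)).le
  -- The shift matters: the `n`th group is the quotient by the lower term of pair `n + 1`, while `A
  -- n` comes from the upper term of pair `n`. Thus `P n` is the image of the upper term of pair `n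
  -- + 1`, with the kernel directly below it.
  let Λ : FiniteInverseSystem.{u} := quotientSystem (fun n => (s (n + 1)).lower) hn hfin hle
  let q (n : ℕ) : G →* Λ.obj n := quotientSystem.proj (fun n => (s (n + 1)).lower) hn hfin hle n
  have hq (n : ℕ) : Function.Surjective (q n) := quotientSystem.proj_surjective _ hn hfin hle n
  have hker (n : ℕ) : (q n).ker = (s (n + 1)).lower := quotientSystem.ker_proj _ hn hfin hle n
  let A (n : ℕ) : Subgroup (Λ.obj n) := (s n).upper.map (q n)
  have hP (n : ℕ) : Λ.P A n = (s (n + 1)).upper.map (q n) :=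
    Subgroup.map_map (s (n + 1)).upper (Λ.map n) (q (n + 1))
  have hmker (n : ℕ) : (Λ.map n).ker = (s (n + 1)).lower.map (q (n + 1)) := by
    ext x
    obtain ⟨g, rfl⟩ := hq (n + 1) x
    have h1 : q (n + 1) g ∈ (Λ.map n).ker ↔ g ∈ (q n).ker := Iff.rfl
    have hle' : (q (n + 1)).ker ≤ (s (n + 1)).lower := (hker (n + 1)).trans_le (hle n)
    rw [h1, hker, ← Subgroup.mem_comap, Subgroup.comap_map_eq_self hle']
  have hcl (n : ℕ) {M : Subgroup G} (hM : M.Normal) (h : (q n).ker ≤ M) : IsClosedNormal M :=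
    isClosedNormal_of_isOpen hM (Subgroup.isOpen_mono ((hker n).ge.trans h) (ho n))
  have hnar (m n : ℕ) (M : Subgroup G) (hM : M.Normal) (h : (q m).ker ≤ M)
      (hlt : M < (s (n + 1)).upper) : M ≤ (s (n + 1)).lower := (hs n).narrow M (hcl m hM h) hlt
  refine ⟨Λ, A, ?_, fun n => ⟨(s n).normal_upper.map _ (hq n), fun h => ?_⟩,
    fun n => ⟨?_, ?_⟩, fun n N hN => ?_, fun n => ?_, fun n => ?_, fun n => ?_⟩
  · refine quotientSystem.nonempty_continuousMulEquiv_limit _ hn hfin hle ho fun g hg => ?_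
    by_contra hg1
    obtain ⟨U, hU⟩ := ProfiniteGrp.exist_openNormalSubgroup_sub_open_nhds_of_one
      (isOpen_compl_singleton (x := g)) (Set.mem_compl_singleton_iff.2 (Ne.symm hg1))
    obtain ⟨i, hi⟩ := hG.exists_le_of_strictAnti (N := fun n => (s (n + 1)).lower)
      (strictAnti_nat_of_succ_lt fun n => hlu (n + 1))
      (fun n => isClosedNormal_of_isOpen (hn n) (ho n)) U.isOpen'
    exact hU (hi (hg i)) rfl
  · exact ((hlu n).trans (s n).lt).not_ge ((map_eq_bot_iff_le (hker n)).1 h)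
  · rw [hmker]
    exact map_le_relMelnikov (hq _) (hn n) (s (n + 1)).lt ((hker _).trans_le (hle n))
      (hnar _ n)
  · rw [hP, hmker]
    exact Subgroup.map_mono (hs (n + 1)).le
  · rw [hP]
    refine ((hs n).oblique (N.comap (q n)) (hcl n (hN.comap _) (Subgroup.ker_le_comap _ _))).imp
      Subgroup.map_le_iff_le_comap.2 fun h => ?_
    rw [← Subgroup.map_comap_eq_self_of_surjective (hq n) N]
    exact Subgroup.map_mono h
  · rw [hP]
    exact isMinimalNormal_map (hq n) inferInstance (s (n + 1)).lt (hker n) (hnar n n)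
  · rw [hP]
    exact (C n).mem_of_mulEquiv _ _ (nonempty_quotient_mulEquiv_map _ (hker n)) (hs n).mem
  · rw [hP]
    -- The centralizer lands in the image of `(s n).lower`, which gives proper containment in `A n`.
    refine lt_of_le_of_lt (centralizer_map_le (hq n) (hker n) (hs n).centralizer_le)
      (lt_of_le_not_ge (Subgroup.map_mono (s n).lt.le) fun h => (s n).lt.not_ge ?_)
    exact (map_le_map_iff_of_ker_le ((hker n).trans_le (hlu n).le)).1 h
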